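/- **Setting.** Let $A\in\mathbb R^{n\times n}$, $0\ne v\in\mathbb R^n$, $\beta=\|v\|_2$, $t>0$, and let $\ell\ge 0$ be an integer. Put $\varphi_0(z)=e^z$ and $\varphi_\ell(z)=\frac1{(\ell-1)!}\int_0^1e^{(1-\theta)z}\theta^{\ell-1}\,d\theta$ for $\ell\ge1$, extended to square matrices. For a real square matrix $M$ let $W(M)=\{(Mx,x)/(x,x): 0\ne x\text{ a complex vector}\}$, and for $a\ge 0$, $0\le\vartheta\le\pi/2$ let $\Sigma_{\vartheta,a}=\{z\in\mathbb C:|\arg(z-a)|\le\vartheta\}$, where the vertex $z=a$ is included. Assume $W(A)\subset\Sigma_{\vartheta,a}$. Run the Arnoldi process on $A$ with $v_1=v/\beta$: for $j=1,2,\dots$ put $h_{ij}=(v_i,Av_j)$ for $i\le j$, $w_j=Av_j-\sum_{i\le j}h_{ij}v_i$, $h_{j+1,j}=\|w_j\|_2$ and $v_{j+1}=w_j/h_{j+1,j}$. Let $k$ be such that $h_{j+1,j}\neq0$ for $1\le j<k$ (if $h_{k+1,k}=0$, the vector $v_{k+1}$ is not needed). Let $V_k=[v_1,\dots,v_k]$,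 let $H_k$ be the $k\times k$ upper Hessenberg matrix of the $h_{ij}$, and let $e_1,e_k$ be the first and last unit vectors of $\mathbb R^k$. Let $\gamma\neq0$ be real with $I+\gamma H_k$ nonsingular, and put $$M_k=(I+\gamma H_k)^{\rm H}(I+\gamma H_k)+\gamma^2h_{k+1,k}^2e_ke_k^{\rm H},\qquad Q_k=M_k^{-1}(I+\gamma H_k)^{\rm H},\qquad T_k=\frac{Q_k^{-1}-I}{\gamma}$$ (so $T_k=H_k+\gamma h_{k+1,k}^2(I+\gamma H_k)^{\rm -H}e_ke_k^{\rm H}$). Assume $W(T_k)\subset\Sigma_{\vartheta,a}$ and $e_k^{\rm H}\varphi_\ell(-tT_k)e_1\ne0$. Let $y(t)=\varphi_\ell(-tA)v$, let $\widehat y_{\ell,k}(t)=V_k\varphi_\ell(-tT_k)\beta e_1$ be the harmonic Arnoldi approximation, and let $\widehat e_{\ell,k}(t)=y(t)-\widehat y_{\ell,k}(t)$ be its error. Its residual is $$\widehat r_{\ell,k}(t)=-A\widehat y_{\ell,k}(t)-\frac{\ell}{t}\widehat y_{\ell,k}(t)+\frac{1}{t(\ell-1)!}v-\widehat y_{\ell,k}'(t)\quad(\ell\ge1),\qquad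 \widehat r_{0,k}(t)=-A\widehat y_{0,k}(t)-\widehat y_{0,k}'(t).$$ Let $\widehat\mu_j=\widehat a_j+\mathbf i\,\widehat b_j$ $(1\le j\le k)$ be the eigenvalues of $T_k$, counted with algebraic multiplicity and ordered so that $\widehat\mu_1,\dots,\widehat\mu_{k_2}$ are exactly the real ones. For $\varepsilon>0$ put $$\widehat r_j=\big((\varepsilon+\widehat a_j)^2+\widehat b_j^2\big)^{1/2},\qquad \widehat R=\max_{1\le j\le k}\widehat r_j,\qquad \widehat\omega_k(\varepsilon)=\prod_{j=1}^k\big(\widehat r_j(\varepsilon+\widehat a_j)\big)^{1/2},$$ $$\widehat c_{\ell,k}=\frac{\exp(t\varepsilon)}{\pi(t\varepsilon)^\ell\,\widehat\omega_k(\varepsilon)(\varepsilon+a)}\cdot\frac{\prod_{j=1}^{k-1}h_{j+1,j}}{|e_k^{\rm H}\varphi_\ell(-tT_k)e_1|}.$$ **Theorem.** If $\varepsilon>0$ and $k+k_2\ge4$, then $$\|\widehat e_{\ell,k}(t)\|_2\le\widehat c_{\ell,k}\cdot\widehat C_k\cdot\|\widehat r_{\ell,k}(t)\|_2,$$ where $$\widehat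 C_k=\frac{\sqrt\pi}{2\sqrt{\widehat S_1}}+\exp(-\varepsilon^2\widehat S_2)(\widehat R-\varepsilon)+\Big(\frac{\varepsilon}{\sqrt{\varepsilon^2+\widehat R^2}}\Big)^{\ell}\frac{\pi\widehat R}{2^{\frac{k+k_2}{4}+1}},$$ $$\widehat S_1=\frac{\ell}{4\varepsilon^2}+\frac12\sum_{j=1}^{k_2}\frac1{\widehat r_j^2+\varepsilon^2}+\frac14\sum_{j=k_2+1}^k\frac1{\widehat r_j^2+\varepsilon^2},\qquad \widehat S_2=\frac{\ell}{2(\varepsilon^2+\widehat R^2)}+\frac12\sum_{j=1}^{k_2}\frac1{\widehat r_j^2+\widehat R^2}+\frac14\sum_{j=k_2+1}^k\frac1{\widehat r_j^2+\widehat R^2}.$$ -/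

import Mathlib

open scoped Nat Matrix Polynomial

noncomputable section

namespace HarmonicArnoldi

/-! ### Matrix `φ`-functions -/

/-- The matrix `φ`-functions: `φ₀(M) = exp M` and, for `ℓ ≥ 1`,
`φ_ℓ(M) = 1/(ℓ-1)! ∫₀¹ exp((1-θ)M) θ^(ℓ-1) dθ`, the integral being taken entrywise. -/
def phi {m : Type*} [Fintype m] [DecidableEq m] : ℕ → Matrix m m ℝ → Matrix m m ℝ
  | 0, M => NormedSpace.exp M
  | p + 1, M => Matrix.of fun i j =>
      1 / (p ! : ℝ) * ∫ θ in (0 : ℝ)..1, (NormedSpace.exp ((1 - θ) • M)) i j * θ ^ p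

/-! ### Numerical range and sectors -/

/-- The numerical range `W(M) = {(Mx,x)/(x,x) : 0 ≠ x ∈ ℂᵐ}` of a real matrix `M`. -/
def numericalRange {m : Type*} [Fintype m] (M : Matrix m m ℝ) : Set ℂ :=
  {z | ∃ x : m → ℂ, x ≠ 0 ∧
    z = (star x ⬝ᵥ (M.map (fun r : ℝ => (r : ℂ)) *ᵥ x)) / (star x ⬝ᵥ x)}

/-- The sector `Σ_{ϑ,a} = {z : |arg(z - a)| ≤ ϑ}`, with its vertex `a` included. -/
def sector (ϑ a : ℝ) : Set ℂ :=
  {z | |Complex.arg (z - (a : ℂ))| ≤ ϑ}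

/-! ### The Arnoldi process

Indices start at `0`, so `arnoldiVec A v j` is the vector usually written `v_{j+1}` and
`arnoldiCoeff A v i j` is `h_{i+1,j+1}`. -/

variable {n : ℕ}

/-- The Arnoldi vectors of `A` with starting vector `v`: the first is `v / ‖v‖`, and the next one
is the normalization of `A v_j - ∑_{i ≤ j} (v_i, A v_j) v_i`. -/
def arnoldiVec (A : Matrix (Fin n) (Fin n) ℝ) (v : EuclideanSpace ℝ (Fin n)) :
    ℕ → EuclideanSpace ℝ (Fin n)
  | 0 => ‖v‖⁻¹ • v
  | j + 1 =>
      let Aq := A.toEuclideanLin (arnoldiVec A v j)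
      let w := Aq - ∑ i : Fin (j + 1), inner ℝ (arnoldiVec A v i) Aq • arnoldiVec A v i
      ‖w‖⁻¹ • w
  termination_by j => j
  decreasing_by all_goals omega

/-- The vector `A v_j - ∑_{i ≤ j} (v_i, A v_j) v_i`, before its normalization. -/
def arnoldiResidue (A : Matrix (Fin n) (Fin n) ℝ) (v : EuclideanSpace ℝ (Fin n)) (j : ℕ) :
    EuclideanSpace ℝ (Fin n) :=
  A.toEuclideanLin (arnoldiVec A v j) -
    ∑ i : Fin (j + 1),
      inner ℝ (arnoldiVec A v i) (A.toEuclideanLin (arnoldiVec A v j)) • arnoldiVec A v i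

/-- The Arnoldi coefficients: `(v_i, A v_j)` on and above the diagonal, the normalization
factors on the subdiagonal, and `0` below it. -/
def arnoldiCoeff (A : Matrix (Fin n) (Fin n) ℝ) (v : EuclideanSpace ℝ (Fin n)) (i j : ℕ) : ℝ :=
  if i ≤ j then inner ℝ (arnoldiVec A v i) (A.toEuclideanLin (arnoldiVec A v j))
  else if i = j + 1 then ‖arnoldiResidue A v j‖
  else 0

/-- The upper Hessenberg matrix `H_k`. -/
def hessenberg (A : Matrix (Fin n) (Fin n) ℝ) (v : EuclideanSpace ℝ (Fin n)) (k : ℕ) :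
    Matrix (Fin k) (Fin k) ℝ :=
  Matrix.of fun i j => arnoldiCoeff A v i j

/-- `V_k u = ∑_j u_j v_j`, where `V_k` has the first `k` Arnoldi vectors as its columns. -/
def basisApply (A : Matrix (Fin n) (Fin n) ℝ) (v : EuclideanSpace ℝ (Fin n)) (k : ℕ)
    (u : Fin k → ℝ) : EuclideanSpace ℝ (Fin n) :=
  ∑ j : Fin k, u j • arnoldiVec A v j

/-- The first unit vector `e₁` of `ℝᵏ`. -/
def eFirst (k : ℕ) : Fin k → ℝ := fun i => if (i : ℕ) = 0 then 1 else 0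

/-- The last unit vector `e_k` of `ℝᵏ`. -/
def eLast (k : ℕ) : Fin k → ℝ := fun i => if (i : ℕ) + 1 = k then 1 else 0

/-! ### The harmonic Arnoldi approximation

All matrices are real, so the conjugate transpose is the transpose. -/

/-- `M_k = (I + γ H_k)ᴴ (I + γ H_k) + γ² h_{k+1,k}² e_k e_kᴴ` (the last Arnoldi coefficient
`h_{k+1,k}` is `arnoldiCoeff A v k (k - 1)` when indices start at `0`). -/
def harmonicM (A : Matrix (Fin n) (Fin n) ℝ) (v : EuclideanSpace ℝ (Fin n)) (k : ℕ) (γ : ℝ) :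
    Matrix (Fin k) (Fin k) ℝ :=
  (1 + γ • hessenberg A v k)ᵀ * (1 + γ • hessenberg A v k) +
    (γ ^ 2 * arnoldiCoeff A v k (k - 1) ^ 2) • Matrix.vecMulVec (eLast k) (eLast k)

/-- `Q_k = M_k⁻¹ (I + γ H_k)ᴴ`. -/
def harmonicQ (A : Matrix (Fin n) (Fin n) ℝ) (v : EuclideanSpace ℝ (Fin n)) (k : ℕ) (γ : ℝ) :
    Matrix (Fin k) (Fin k) ℝ :=
  (harmonicM A v k γ)⁻¹ * (1 + γ • hessenberg A v k)ᵀ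

/-- `T_k = (Q_k⁻¹ - I) / γ`. -/
def harmonicT (A : Matrix (Fin n) (Fin n) ℝ) (v : EuclideanSpace ℝ (Fin n)) (k : ℕ) (γ : ℝ) :
    Matrix (Fin k) (Fin k) ℝ :=
  γ⁻¹ • ((harmonicQ A v k γ)⁻¹ - 1)

/-- The exact vector `y(t) = φ_ℓ(-tA) v`. -/
def exactSol (A : Matrix (Fin n) (Fin n) ℝ) (v : EuclideanSpace ℝ (Fin n)) (l : ℕ) (t : ℝ) :
    EuclideanSpace ℝ (Fin n) :=
  (phi l (-(t • A))).toEuclideanLin v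

/-- The harmonic Arnoldi approximation `ŷ_{ℓ,k}(t) = V_k φ_ℓ(-t T_k) β e₁`, `β = ‖v‖`. -/
def harmonicApprox (A : Matrix (Fin n) (Fin n) ℝ) (v : EuclideanSpace ℝ (Fin n)) (k : ℕ) (γ : ℝ)
    (l : ℕ) (t : ℝ) : EuclideanSpace ℝ (Fin n) :=
  basisApply A v k (phi l (-(t • harmonicT A v k γ)) *ᵥ (‖v‖ • eFirst k))

/-- The error `ê_{ℓ,k}(t) = y(t) - ŷ_{ℓ,k}(t)`. -/
def harmonicError (A : Matrix (Fin n) (Fin n) ℝ) (v : EuclideanSpace ℝ (Fin n)) (k : ℕ) (γ : ℝ)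
    (l : ℕ) (t : ℝ) : EuclideanSpace ℝ (Fin n) :=
  exactSol A v l t - harmonicApprox A v k γ l t

/-- The residual `r̂_{ℓ,k}(t)` of the harmonic Arnoldi approximation: `-A ŷ - ŷ'` for `ℓ = 0`, and
`-A ŷ - (ℓ/t) ŷ + v / (t (ℓ-1)!) - ŷ'` for `ℓ ≥ 1`. -/
def harmonicResidual (A : Matrix (Fin n) (Fin n) ℝ) (v : EuclideanSpace ℝ (Fin n)) (k : ℕ) (γ : ℝ)
    (l : ℕ) (t : ℝ) : EuclideanSpace ℝ (Fin n) :=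
  match l with
  | 0 => -A.toEuclideanLin (harmonicApprox A v k γ 0 t) - deriv (harmonicApprox A v k γ 0) t
  | p + 1 =>
      -A.toEuclideanLin (harmonicApprox A v k γ (p + 1) t)
        - (((p + 1 : ℕ) : ℝ) / t) • harmonicApprox A v k γ (p + 1) t
        + (1 / (t * (p ! : ℝ))) • v
        - deriv (harmonicApprox A v k γ (p + 1)) t

/-- The entry `e_kᴴ φ_ℓ(-t T_k) e₁`. -/
def cornerEntry (A : Matrix (Fin n) (Fin n) ℝ) (v : EuclideanSpace ℝ (Fin n)) (k : ℕ) (γ : ℝ)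
    (l : ℕ) (t : ℝ) : ℝ :=
  eLast k ⬝ᵥ (phi l (-(t • harmonicT A v k γ)) *ᵥ eFirst k)

/-! ### The constants, in terms of the eigenvalues `μ_0, …, μ_{k-1}` -/

variable {k : ℕ}

/-- `r_j = ((ε + a_j)² + b_j²)^{1/2}` for the eigenvalue `μ_j = a_j + i b_j`. -/
def rad (ε : ℝ) (μ : Fin k → ℂ) (j : Fin k) : ℝ :=
  Real.sqrt ((ε + (μ j).re) ^ 2 + (μ j).im ^ 2)

/-- `R = max_j r_j`. -/
def radMax (ε : ℝ) (μ : Fin k → ℂ) : ℝ := ⨆ j : Fin k, rad ε μ j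

/-- `ω_k(ε) = ∏_j (r_j (ε + a_j))^{1/2}`. -/
def omegaProd (ε : ℝ) (μ : Fin k → ℂ) : ℝ :=
  ∏ j : Fin k, Real.sqrt (rad ε μ j * (ε + (μ j).re))

/-- `S₁`; the first `k₂` eigenvalues are the real ones. -/
def sumOne (ε : ℝ) (μ : Fin k → ℂ) (k₂ l : ℕ) : ℝ :=
  (l : ℝ) / (4 * ε ^ 2)
    + 1 / 2 * ∑ j ∈ Finset.univ.filter (fun j : Fin k => (j : ℕ) < k₂),
        1 / (rad ε μ j ^ 2 + ε ^ 2)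
    + 1 / 4 * ∑ j ∈ Finset.univ.filter (fun j : Fin k => k₂ ≤ (j : ℕ)),
        1 / (rad ε μ j ^ 2 + ε ^ 2)

/-- `S₂`; the first `k₂` eigenvalues are the real ones. -/
def sumTwo (ε : ℝ) (μ : Fin k → ℂ) (k₂ l : ℕ) : ℝ :=
  (l : ℝ) / (2 * (ε ^ 2 + radMax ε μ ^ 2))
    + 1 / 2 * ∑ j ∈ Finset.univ.filter (fun j : Fin k => (j : ℕ) < k₂),
        1 / (rad ε μ j ^ 2 + radMax ε μ ^ 2)
    + 1 / 4 * ∑ j ∈ Finset.univ.filter (fun j : Fin k => k₂ ≤ (j : ℕ)),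
        1 / (rad ε μ j ^ 2 + radMax ε μ ^ 2)

/-- The constant `Ĉ_k`. -/
def bigC (ε : ℝ) (μ : Fin k → ℂ) (k₂ l : ℕ) : ℝ :=
  Real.sqrt Real.pi / (2 * Real.sqrt (sumOne ε μ k₂ l))
    + Real.exp (-ε ^ 2 * sumTwo ε μ k₂ l) * (radMax ε μ - ε)
    + (ε / Real.sqrt (ε ^ 2 + radMax ε μ ^ 2)) ^ l
        * (Real.pi * radMax ε μ / (2 : ℝ) ^ (((k : ℝ) + (k₂ : ℝ)) / 4 + 1))

/-- The constant `ĉ_{ℓ,k}`. -/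
def smallC (A : Matrix (Fin n) (Fin n) ℝ) (v : EuclideanSpace ℝ (Fin n)) (γ ε a : ℝ)
    (μ : Fin k → ℂ) (l : ℕ) (t : ℝ) : ℝ :=
  Real.exp (t * ε) / (Real.pi * (t * ε) ^ l * omegaProd ε μ * (ε + a))
    * ((∏ j ∈ Finset.range (k - 1), arnoldiCoeff A v (j + 1) j) / |cornerEntry A v k γ l t|)

end HarmonicArnoldi

end

/-! The proof runs in the Laplace domain. The function `s ^ l • φ_l(-sB)u` solves a linear
differential equation, and its transform is `z^{-l}(z + B)^{-1}u` on `Re z > 0` (`laplace_phiFlow`).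
Take `B = A` with `u = v`, and `B = T_k` with `u = β e₁`. About the Arnoldi basis only two facts
enter: `V_k β e₁ = v`, and `A V_k = V_k T_k + g e_kᵀ` for some vector `g`. The second one survives
the harmonic modification because `T_k` differs from `H_k` only in its last column.

Together they show that the transform `E(z)` of `s^l` times the error satisfies `(z + A)E(z) = -σ(z)
g`, where `σ(z)` is the last component of `z^{-l}(z + T_k)^{-1} β e₁`. The numerical range bounds
the resolvent of `A` by `1 / (Re z + a)`. Cramer's rule for a Hessenberg matrix gives `|σ(z)| = β ∏
h_{j+1,j} / (|z|^l ∏ |z + μ_j|)`. This is `norm_resolvent_error_le`. The residual is `-β (e_kᵀ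
φ_l(-tT_k) e₁) g` (`harmonicResidual_eq`), so `‖g‖` is the residual norm divided by an explicit
factor.

Fourier inversion along `Re z = ε` (`norm_le_of_norm_laplace_le`) turns the bound on `E` into a
bound at time `t`. Since `T_k` is real, each `|z + μ_j|` may be averaged with `|z + conj μ_j|`. The
integrand is then dominated by `freqWeight` up to the factor `1 / (ε^l ω_k(ε))` (`omegaProd_le`).
Splitting the half-line at `ε` and `R` gives a Gaussian, a constant and an arctangent tail, which
are the three terms of `Ĉ_k` (`integral_freqWeight_le`). -/

noncomputable section

/-! ### Matrix exponentials and the differential equation of the φ-functions. -/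

namespace HarmonicArnoldi

open scoped Matrix.Norms.Operator in
theorem hasDerivAt_exp_neg_smul_mulVec {m : Type*} [Fintype m] [DecidableEq m]
    (B : Matrix m m ℝ) (u : m → ℝ) (s : ℝ) :
    HasDerivAt (fun s : ℝ => NormedSpace.exp (-(s • B)) *ᵥ u)
      (-(B *ᵥ (NormedSpace.exp (-(s • B)) *ᵥ u))) s := by
  have h := hasDerivAt_exp_smul_const' (𝕂 := ℝ) (-B) s
  have h2 := ((Matrix.mulVecBilin ℝ ℝ).flip u).toContinuousLinearMap.hasFDerivAt.comp_hasDerivAt s h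
  simp only [smul_neg] at h2
  refine h2.congr_deriv ?_
  change (-B * NormedSpace.exp (-(s • B))) *ᵥ u = _
  rw [Matrix.neg_mul, Matrix.neg_mulVec, Matrix.mulVec_mulVec]

theorem hasDerivAt_exp_neg_smul_entry {m : Type*} [Fintype m] [DecidableEq m]
    (B : Matrix m m ℝ) (s : ℝ) (i j : m) :
    HasDerivAt (fun s : ℝ => NormedSpace.exp (-(s • B)) i j)
      (-(B * NormedSpace.exp (-(s • B))) i j) s := by
  have h := hasDerivAt_exp_neg_smul_mulVec B (Pi.single j 1) s
  have := (hasDerivAt_pi.1 h) i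
  simp only [Matrix.mulVec_single_one, Matrix.col_apply] at this
  exact this

theorem continuous_exp_smul_entry {m : Type*} [Fintype m] [DecidableEq m]
    (B : Matrix m m ℝ) (i j : m) :
    Continuous (fun s : ℝ => NormedSpace.exp (s • B) i j) := by
  have : Differentiable ℝ (fun s : ℝ => NormedSpace.exp (-(s • (-B))) i j) := fun s =>
    (hasDerivAt_exp_neg_smul_entry (-B) s i j).differentiableAt
  simpa using this.continuous

/-- If `x ⬝ Bx ≥ 0` for all `x`, the semigroup `exp (-sB)` is a contraction. -/
theorem dotProduct_exp_neg_smul_le {m : Type*} [Fintype m] [DecidableEq m]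
    (B : Matrix m m ℝ) (hB : ∀ x : m → ℝ, 0 ≤ x ⬝ᵥ (B *ᵥ x)) (u : m → ℝ) {s : ℝ} (hs : 0 ≤ s) :
    (NormedSpace.exp (-(s • B)) *ᵥ u) ⬝ᵥ (NormedSpace.exp (-(s • B)) *ᵥ u) ≤ u ⬝ᵥ u := by
  set q : ℝ → m → ℝ := fun s => NormedSpace.exp (-(s • B)) *ᵥ u with hq
  have hd : ∀ s, HasDerivAt (fun s => q s ⬝ᵥ q s) (-2 * (q s ⬝ᵥ (B *ᵥ q s))) s := by
    intro s
    have h := hasDerivAt_pi.1 (hasDerivAt_exp_neg_smul_mulVec B u s)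
    have h2 := HasDerivAt.fun_sum (u := Finset.univ) (fun i _ => (h i).mul (h i))
    refine (h2.congr_deriv ?_)
    simp only [dotProduct, Finset.mul_sum, Pi.neg_apply, hq]
    exact Finset.sum_congr rfl fun i _ => by ring
  have hanti : Antitone (fun s => q s ⬝ᵥ q s) := by
    refine antitone_of_deriv_nonpos (fun s => (hd s).differentiableAt) fun s => ?_
    rw [(hd s).deriv]
    have := hB (q s)
    linarith
  have h0 := hanti hs
  simpa [hq] using h0

theorem abs_exp_neg_smul_entry_le {m : Type*} [Fintype m] [DecidableEq m]
    (B : Matrix m m ℝ) (hB : ∀ x : m → ℝ, 0 ≤ x ⬝ᵥ (B *ᵥ x)) {s : ℝ} (hs : 0 ≤ s) (i j : m) :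
    |NormedSpace.exp (-(s • B)) i j| ≤ 1 := by
  have h := dotProduct_exp_neg_smul_le B hB (Pi.single j 1) hs
  simp only [Matrix.mulVec_single_one, dotProduct_single, Pi.single_eq_same, mul_one] at h
  have h1 : (NormedSpace.exp (-(s • B)) i j) ^ 2 ≤ 1 := by
    refine le_trans ?_ h
    rw [dotProduct, sq]
    exact Finset.single_le_sum (f := fun i => (NormedSpace.exp (-(s • B))).col j i *
      (NormedSpace.exp (-(s • B))).col j i) (fun i _ => mul_self_nonneg _) (Finset.mem_univ i)
  exact (sq_le_one_iff_abs_le_one _).1 h1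

/-- A crude bound that suffices: it makes `s ^ l • φ_l(-sB)u` grow at most polynomially, so that its
Laplace transform converges on the whole right half-plane. -/
theorem abs_phi_entry_le {m : Type*} [Fintype m] [DecidableEq m]
    (B : Matrix m m ℝ) (hB : ∀ x : m → ℝ, 0 ≤ x ⬝ᵥ (B *ᵥ x)) (l : ℕ) {s : ℝ} (hs : 0 ≤ s)
    (i j : m) : |phi l (-(s • B)) i j| ≤ 1 := by
  cases l with
  | zero => exact abs_exp_neg_smul_entry_le B hB hs i j
  | succ p =>
    simp only [phi, Matrix.of_apply, abs_mul]
    have h1 : |1 / (p ! : ℝ)| ≤ 1 := by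
      rw [abs_of_nonneg (by positivity), div_le_one (by positivity)]
      exact_mod_cast p.factorial_pos
    have h2 : |∫ θ in (0 : ℝ)..1, (NormedSpace.exp ((1 - θ) • -(s • B))) i j * θ ^ p| ≤ 1 := by
      have := intervalIntegral.norm_integral_le_of_norm_le_const (a := (0 : ℝ)) (b := 1) (C := 1)
        (f := fun θ => (NormedSpace.exp ((1 - θ) • -(s • B))) i j * θ ^ p) ?_
      · simpa using this
      · intro θ hθ
        rw [Set.uIoc_of_le zero_le_one] at hθ
        have e : (1 - θ) • -(s • B) = -(((1 - θ) * s) • B) := by rw [smul_neg, smul_smul]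
        rw [e, norm_mul, Real.norm_eq_abs, Real.norm_eq_abs, abs_pow, abs_of_pos hθ.1]
        exact mul_le_one₀ (abs_exp_neg_smul_entry_le B hB (mul_nonneg (by linarith [hθ.2]) hs) i j)
          (by have := hθ.1; positivity) (pow_le_one₀ hθ.1.le hθ.2)
    exact mul_le_one₀ h1 (abs_nonneg _) h2

/-- The vector `s^l φ_l(-sB) u`. -/
def phiFlow {m : Type*} [Fintype m] [DecidableEq m] (B : Matrix m m ℝ) (u : m → ℝ) (l : ℕ)
    (s : ℝ) : m → ℝ :=
  s ^ l • (phi l (-(s • B)) *ᵥ u)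

/-- The inhomogeneity of the differential equation of `phiFlow`. -/
def phiSource : ℕ → ℝ → ℝ
  | 0, _ => 0
  | p + 1, s => s ^ p / (p ! : ℝ)

theorem phiFlow_zero_left {m : Type*} [Fintype m] [DecidableEq m] (B : Matrix m m ℝ) (u : m → ℝ)
    (l : ℕ) : phiFlow B u l 0 = (0 : ℝ) ^ l • u := by
  cases l with
  | zero => simp [phiFlow, phi]
  | succ p => simp [phiFlow]

/-- Substitute `τ = θ s` and split `exp((1-θ)(-sB)) = exp(-sB) exp(τB)`. In this Duhamel form `s`
occurs only in the outer exponential and in the upper limit, so the product rule and the fundamental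
theorem of calculus give the derivative. -/
theorem pow_smul_phi_succ {m : Type*} [Fintype m] [DecidableEq m] (B : Matrix m m ℝ) (p : ℕ)
    (s : ℝ) :
    s ^ (p + 1) • phi (p + 1) (-(s • B)) = NormedSpace.exp (-(s • B)) *
      Matrix.of fun i j => ∫ τ in (0 : ℝ)..s, NormedSpace.exp (τ • B) i j * (τ ^ p / (p ! : ℝ)) := by
  ext i j
  simp only [phi, Matrix.smul_apply, Matrix.of_apply, Matrix.mul_apply, smul_eq_mul]
  have e1 : ∀ θ : ℝ, (NormedSpace.exp ((1 - θ) • -(s • B))) i j * θ ^ p =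
      ∑ q, NormedSpace.exp (-(s • B)) i q * (NormedSpace.exp ((θ * s) • B) q j * θ ^ p) := by
    intro θ
    have : (1 - θ) • -(s • B) = -(s • B) + (θ * s) • B := by
      rw [smul_neg, smul_smul, ← neg_smul, ← neg_smul, ← add_smul]
      congr 1; ring
    rw [this, Matrix.exp_add_of_commute _ _
      (((Commute.refl B).smul_right _).smul_left _).neg_left, Matrix.mul_apply, Finset.sum_mul]
    exact Finset.sum_congr rfl fun q _ => by ring
  simp only [e1]
  have hc : ∀ q, Continuous fun θ : ℝ => NormedSpace.exp ((θ * s) • B) q j := fun q =>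
    (continuous_exp_smul_entry B q j).comp (by fun_prop)
  rw [intervalIntegral.integral_finsetSum]
  swap
  · intro q _
    exact (continuous_const.mul ((hc q).mul (continuous_pow p))).intervalIntegrable _ _
  rw [Finset.mul_sum, Finset.mul_sum]
  refine Finset.sum_congr rfl fun q _ => ?_
  rw [intervalIntegral.integral_const_mul]
  have h := intervalIntegral.mul_integral_comp_mul_right (a := 0) (b := 1)
    (f := fun τ => NormedSpace.exp (τ • B) q j * (τ ^ p / (p ! : ℝ))) s
  rw [zero_mul, one_mul] at h
  rw [← h]
  have h3 : ∀ x : ℝ, NormedSpace.exp ((x * s) • B) q j * ((x * s) ^ p / (p ! : ℝ)) =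
      (s ^ p / (p ! : ℝ)) * (NormedSpace.exp ((x * s) • B) q j * x ^ p) := by
    intro x; rw [mul_pow]; ring
  simp only [h3]
  rw [intervalIntegral.integral_const_mul]
  ring

theorem hasDerivAt_phiFlow {m : Type*} [Fintype m] [DecidableEq m] (B : Matrix m m ℝ) (u : m → ℝ)
    (l : ℕ) (s : ℝ) :
    HasDerivAt (phiFlow B u l) (-(B *ᵥ phiFlow B u l s) + phiSource l s • u) s := by
  cases l with
  | zero =>
    have h : phiFlow B u 0 = fun s : ℝ => NormedSpace.exp (-(s • B)) *ᵥ u := by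
      ext s; simp [phiFlow, phi]
    simpa [h, phiSource] using hasDerivAt_exp_neg_smul_mulVec B u s
  | succ p =>
    set J : ℝ → Matrix m m ℝ := fun s => Matrix.of fun i j =>
      ∫ τ in (0 : ℝ)..s, NormedSpace.exp (τ • B) i j * (τ ^ p / (p ! : ℝ)) with hJ
    have h : phiFlow B u (p + 1) = fun s : ℝ => (NormedSpace.exp (-(s • B)) * J s) *ᵥ u := by
      ext s : 1
      rw [phiFlow, ← Matrix.smul_mulVec, pow_smul_phi_succ]
    have hJd : ∀ i j, HasDerivAt (fun s => J s i j)
        (NormedSpace.exp (s • B) i j * (s ^ p / (p ! : ℝ))) s := by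
      intro i j
      have hc : Continuous fun τ : ℝ => NormedSpace.exp (τ • B) i j * (τ ^ p / (p ! : ℝ)) := by
        exact (continuous_exp_smul_entry B i j).mul ((continuous_pow p).div_const _)
      exact hc.integral_hasStrictDerivAt 0 s |>.hasDerivAt
    have hE : NormedSpace.exp (-(s • B)) * NormedSpace.exp (s • B) = 1 := by
      rw [← Matrix.exp_add_of_commute (-(s • B)) (s • B) (Commute.refl (s • B)).neg_left,
        neg_add_cancel, NormedSpace.exp_zero]
    rw [h, hasDerivAt_pi]
    intro i
    have hd := HasDerivAt.fun_sum (u := Finset.univ) (fun j (_ : j ∈ Finset.univ) =>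
      (HasDerivAt.fun_sum (u := Finset.univ) (fun q (_ : q ∈ Finset.univ) =>
        (hasDerivAt_exp_neg_smul_entry B s i q).mul (hJd q j))).mul_const (u j))
    refine (hd.congr_deriv ?_).congr_of_eventuallyEq (Filter.Eventually.of_forall fun s => ?_)
    · have e1 : ∀ j, ∑ q, NormedSpace.exp (-(s • B)) i q *
          (NormedSpace.exp (s • B) q j * (s ^ p / (p ! : ℝ))) =
          (1 : Matrix m m ℝ) i j * (s ^ p / (p ! : ℝ)) := by
        intro j
        rw [← hE, Matrix.mul_apply, Finset.sum_mul]
        exact Finset.sum_congr rfl fun q _ => by ring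
      have e2 : ∀ j, ∑ q, -(B * NormedSpace.exp (-(s • B))) i q * J s q j =
          -(B * (NormedSpace.exp (-(s • B)) * J s)) i j := by
        intro j
        rw [← Matrix.mul_assoc, Matrix.mul_apply (M := B * _), ← Finset.sum_neg_distrib]
        exact Finset.sum_congr rfl fun q _ => by ring
      simp only [Finset.sum_add_distrib, e1, e2]
      simp only [add_mul, Finset.sum_add_distrib, Pi.add_apply, Pi.neg_apply, Pi.smul_apply,
        phiSource, Matrix.mulVec_mulVec]
      congr 1
      · simp [Matrix.mulVec, dotProduct]
      · simp [Matrix.one_apply]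
    · simp [Matrix.mulVec, dotProduct, Matrix.mul_apply]

theorem abs_phiFlow_le {m : Type*} [Fintype m] [DecidableEq m]
    (B : Matrix m m ℝ) (hB : ∀ x : m → ℝ, 0 ≤ x ⬝ᵥ (B *ᵥ x)) (u : m → ℝ) (l : ℕ) {s : ℝ}
    (hs : 0 ≤ s) (i : m) : |phiFlow B u l s i| ≤ (∑ j, |u j|) * s ^ l := by
  rw [phiFlow, Pi.smul_apply, smul_eq_mul, abs_mul, abs_of_nonneg (pow_nonneg hs l), mul_comm]
  refine mul_le_mul_of_nonneg_right ?_ (pow_nonneg hs l)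
  refine (Finset.abs_sum_le_sum_abs _ _).trans (Finset.sum_le_sum fun j _ => ?_)
  rw [abs_mul]
  exact mul_le_of_le_one_left (abs_nonneg _) (abs_phi_entry_le B hB l hs i j)

end HarmonicArnoldi
end

/-! ### Laplace transforms of functions of subexponential growth. -/

noncomputable section

namespace HarmonicArnoldi

open MeasureTheory Filter Asymptotics Set Topology

/-- A continuous function that grows more slowly than every exponential. -/
structure IsSubexponential (f : ℝ → ℂ) : Prop where
  continuous : Continuous f
  isBigO : ∀ δ > 0, f =O[atTop] fun s => Real.exp (δ * s)

theorem IsSubexponential.add {f g : ℝ → ℂ} (hf : IsSubexponential f) (hg : IsSubexponential g) :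
    IsSubexponential fun s => f s + g s :=
  ⟨hf.1.add hg.1, fun δ hδ => (hf.2 δ hδ).add (hg.2 δ hδ)⟩

theorem IsSubexponential.const_mul {f : ℝ → ℂ} (hf : IsSubexponential f) (c : ℂ) :
    IsSubexponential fun s => c * f s :=
  ⟨continuous_const.mul hf.1, fun δ hδ => (hf.2 δ hδ).const_mul_left c⟩

theorem IsSubexponential.sum {ι : Type*} (σ : Finset ι) {f : ι → ℝ → ℂ}
    (hf : ∀ i ∈ σ, IsSubexponential (f i)) : IsSubexponential fun s => ∑ i ∈ σ, f i s :=
  ⟨continuous_finsetSum _ fun i hi => (hf i hi).1,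
    fun δ hδ => by
      simpa only [Finset.sum_fn] using IsBigO.sum fun i hi => (hf i hi).2 δ hδ⟩

theorem isSubexponential_of_le_pow {f : ℝ → ℂ} (hf : Continuous f) (C : ℝ) (d : ℕ)
    (h : ∀ s, 0 ≤ s → ‖f s‖ ≤ C * s ^ d) : IsSubexponential f := by
  refine ⟨hf, fun δ hδ => IsBigO.trans (g := fun s : ℝ => s ^ d) ?_
    (isLittleO_pow_exp_pos_mul_atTop d hδ).isBigO⟩
  refine IsBigO.of_bound C ?_
  filter_upwards [eventually_ge_atTop 0] with s hs
  rw [Real.norm_of_nonneg (pow_nonneg hs d)]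
  exact h s hs

theorem isSubexponential_pow (d : ℕ) : IsSubexponential fun s => (s : ℂ) ^ d :=
  isSubexponential_of_le_pow (by fun_prop) 1 d fun s hs => by
    rw [norm_pow, Complex.norm_real, Real.norm_of_nonneg hs, one_mul]

/-- The Laplace transform. -/
def laplace (f : ℝ → ℂ) (z : ℂ) : ℂ := ∫ s in Ioi (0 : ℝ), Complex.exp (-(z * s)) * f s

theorem IsSubexponential.isBigO_exp_mul {f : ℝ → ℂ} (hf : IsSubexponential f) {z : ℂ}
    (hz : 0 < z.re) :
    (fun s : ℝ => Complex.exp (-(z * s)) * f s) =O[atTop]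
      fun s => Real.exp (-(z.re / 2) * s) := by
  have h1 : (fun s : ℝ => Complex.exp (-(z * s))) =O[atTop]
      fun s : ℝ => Real.exp (-(z.re * s)) :=
    IsBigO.of_bound 1 (Eventually.of_forall fun s => by
      rw [Complex.norm_exp]
      simp)
  refine (h1.mul (hf.2 (z.re / 2) (by positivity))).congr_right fun s => ?_
  rw [← Real.exp_add]
  ring_nf

theorem IsSubexponential.integrableOn {f : ℝ → ℂ} (hf : IsSubexponential f) {z : ℂ}
    (hz : 0 < z.re) :
    IntegrableOn (fun s : ℝ => Complex.exp (-(z * s)) * f s) (Ioi 0) := by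
  have hc : Continuous fun s : ℝ => Complex.exp (-(z * s)) * f s := by
    have := hf.1
    fun_prop
  exact integrableOn_Ici_iff_integrableOn_Ioi (by finiteness) |>.mp <|
    (hc.continuousOn.locallyIntegrableOn measurableSet_Ici).integrableOn_of_isBigO_atTop
    (hf.isBigO_exp_mul hz)
    ⟨Ioi (z.re / 2), Ioi_mem_atTop (z.re / 2), exp_neg_integrableOn_Ioi _ (by positivity)⟩

theorem IsSubexponential.tendsto {f : ℝ → ℂ} (hf : IsSubexponential f) {z : ℂ}
    (hz : 0 < z.re) :
    Tendsto (fun s : ℝ => Complex.exp (-(z * s)) * f s) atTop (𝓝 0) := by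
  refine (hf.isBigO_exp_mul hz).trans_tendsto ?_
  refine Real.tendsto_exp_atBot.comp ?_
  exact tendsto_id.const_mul_atTop_of_neg (by linarith)

theorem laplace_deriv {f f' : ℝ → ℂ} (hf : IsSubexponential f) (hf' : IsSubexponential f')
    (hd : ∀ s, HasDerivAt f (f' s) s) {z : ℂ} (hz : 0 < z.re) :
    laplace f' z = z * laplace f z - f 0 := by
  have h := integral_Ioi_of_hasDerivAt_of_tendsto' (a := 0)
    (f := fun s : ℝ => Complex.exp (-(z * s)) * f s)
    (f' := fun s : ℝ => Complex.exp (-(z * s)) * f' s - z * (Complex.exp (-(z * s)) * f s))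
    (m := 0) ?_ ?_ (hf.tendsto hz)
  · rw [integral_sub (hf'.integrableOn hz) ((hf.integrableOn hz).const_mul z),
      integral_const_mul] at h
    simp only [Complex.ofReal_zero, mul_zero, neg_zero, Complex.exp_zero, one_mul, zero_sub] at h
    rw [laplace, laplace]
    linear_combination h
  · intro s _
    have h1 : HasDerivAt (fun s : ℝ => Complex.exp (-(z * s)))
        (Complex.exp (-(z * s)) * -(z * 1)) s :=
      (((hasDerivAt_id s).ofReal_comp.const_mul z).neg).cexp
    exact (h1.mul (hd s)).congr_deriv (by ring)
  · exact (hf'.integrableOn hz).sub ((hf.integrableOn hz).const_mul z)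

theorem laplace_add {f g : ℝ → ℂ} (hf : IsSubexponential f) (hg : IsSubexponential g) {z : ℂ}
    (hz : 0 < z.re) : laplace (fun s => f s + g s) z = laplace f z + laplace g z := by
  simp only [laplace, mul_add]
  exact integral_add (hf.integrableOn hz) (hg.integrableOn hz)

theorem laplace_const_mul (f : ℝ → ℂ) (c z : ℂ) :
    laplace (fun s => c * f s) z = c * laplace f z := by
  simp only [laplace, mul_left_comm _ c]
  exact integral_const_mul _ _

theorem laplace_sum {ι : Type*} (σ : Finset ι) {f : ι → ℝ → ℂ}
    (hf : ∀ i ∈ σ, IsSubexponential (f i)) {z : ℂ} (hz : 0 < z.re) :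
    laplace (fun s => ∑ i ∈ σ, f i s) z = ∑ i ∈ σ, laplace (f i) z := by
  simp only [laplace, Finset.mul_sum]
  exact integral_finsetSum _ fun i hi => (hf i hi).integrableOn hz

theorem laplace_pow (p : ℕ) {z : ℂ} (hz : 0 < z.re) :
    laplace (fun s => (s : ℂ) ^ p / (p ! : ℂ)) z = (z ^ (p + 1))⁻¹ := by
  have hz0 : z ≠ 0 := fun h => by simp [h] at hz
  have hs : ∀ d : ℕ, IsSubexponential fun s => (s : ℂ) ^ d / (d ! : ℂ) := fun d => by
    simpa only [div_eq_inv_mul] using (isSubexponential_pow d).const_mul _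
  induction p with
  | zero =>
    have h := laplace_deriv (hs 0) (f' := fun _ => 0)
      (by simpa using (hs 0).const_mul 0) (fun s => by simpa using hasDerivAt_const s (1 : ℂ)) hz
    simp only [laplace, mul_zero, integral_zero, pow_zero, Nat.factorial_zero, Nat.cast_one,
      div_one] at h ⊢
    rw [zero_add, pow_one, ← mul_eq_one_iff_eq_inv₀ hz0]
    linear_combination -h
  | succ p ih =>
    have h := laplace_deriv (hs (p + 1)) (hs p) (fun s => by
      have h1 := ((hasDerivAt_id s).ofReal_comp.pow (p + 1)).div_const (((p + 1) ! : ℕ) : ℂ)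
      refine h1.congr_deriv ?_
      have : ((p ! : ℕ) : ℂ) ≠ 0 := by exact_mod_cast p.factorial_ne_zero
      have h2 : ((p : ℂ) + 1) ≠ 0 := by exact_mod_cast p.succ_ne_zero
      rw [Nat.factorial_succ]
      push_cast
      simp only [id, mul_one]
      field_simp) hz
    rw [ih] at h
    simp only [Complex.ofReal_zero, ne_eq, Nat.succ_ne_zero, not_false_eq_true, zero_pow, zero_div,
      sub_zero] at h
    rw [pow_succ z (p + 1), mul_inv, h]
    field_simp

variable {m : Type*} [Fintype m] [DecidableEq m]

theorem isSubexponential_phiFlow (B : Matrix m m ℝ) (hB : ∀ x : m → ℝ, 0 ≤ x ⬝ᵥ (B *ᵥ x))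
    (u : m → ℝ) (l : ℕ) (i : m) : IsSubexponential fun s => (phiFlow B u l s i : ℂ) := by
  refine isSubexponential_of_le_pow ?_ (∑ j, |u j|) l fun s hs => ?_
  · have : Differentiable ℝ fun s => phiFlow B u l s i := fun s =>
      (hasDerivAt_pi.1 (hasDerivAt_phiFlow B u l s) i).differentiableAt
    exact Complex.continuous_ofReal.comp this.continuous
  · rw [Complex.norm_real]
    exact abs_phiFlow_le B hB u l hs i

/-- The Laplace transform of `phiFlow B u l` solves `(z + B) X = z^{-l} u`. -/
theorem laplace_phiFlow (B : Matrix m m ℝ) (hB : ∀ x : m → ℝ, 0 ≤ x ⬝ᵥ (B *ᵥ x))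
    (u : m → ℝ) (l : ℕ) {z : ℂ} (hz : 0 < z.re) :
    (z • (1 : Matrix m m ℂ) + B.map (fun r : ℝ => (r : ℂ))) *ᵥ
      (fun i => laplace (fun s => (phiFlow B u l s i : ℂ)) z) = fun i => (z ^ l)⁻¹ * (u i : ℂ) := by
  have hsrc : IsSubexponential fun s => (phiSource l s : ℂ) := by
    cases l with
    | zero => simpa [phiSource] using (isSubexponential_pow 0).const_mul 0
    | succ p => simpa [phiSource, div_eq_inv_mul] using (isSubexponential_pow p).const_mul _
  have hψ := isSubexponential_phiFlow B hB u l
  ext i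
  have hsum : IsSubexponential fun s => ∑ j, (-(B i j) : ℂ) * (phiFlow B u l s j : ℂ) :=
    IsSubexponential.sum _ fun j _ => (hψ j).const_mul _
  have h := laplace_deriv (hψ i) (hsum.add (hsrc.const_mul (u i))) (fun s => by
    have h1 := (hasDerivAt_pi.1 (hasDerivAt_phiFlow B u l s) i).ofReal_comp
    refine h1.congr_deriv ?_
    simp [Matrix.mulVec, dotProduct, mul_comm]) hz
  rw [laplace_add hsum (hsrc.const_mul _) hz, laplace_const_mul,
    laplace_sum _ (fun j _ => (hψ j).const_mul _) hz] at h
  simp only [laplace_const_mul, phiFlow_zero_left] at h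
  rw [Matrix.add_mulVec, Matrix.smul_mulVec, Matrix.one_mulVec]
  simp only [Pi.add_apply, Pi.smul_apply, Matrix.mulVec, dotProduct, Matrix.map_apply, smul_eq_mul]
  simp only [neg_mul, Finset.sum_neg_distrib] at h
  -- For `l = 0` the source vanishes and the initial value contributes `1`; for `l ≥ 1` the initial
  -- value vanishes and the source contributes `z^{-l}`.
  have hl : laplace (fun s => (phiSource l s : ℂ)) z + (0 : ℂ) ^ l = (z ^ l)⁻¹ := by
    cases l with
    | zero => simp [phiSource, laplace]
    | succ p =>
      have := laplace_pow p hz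
      simpa [phiSource] using this
  rw [← hl]
  simp only [Pi.smul_apply, smul_eq_mul] at h
  push_cast at h
  linear_combination -h

end HarmonicArnoldi
end

/-! ### Numerical range, resolvent bounds and eigenvalues. -/

noncomputable section

namespace HarmonicArnoldi

section NumericalRange

variable {m : Type*} [Fintype m]

theorem star_dotProduct_self_eq (x : m → ℂ) :
    star x ⬝ᵥ x = ((∑ i, ‖x i‖ ^ 2 : ℝ) : ℂ) := by
  simp [dotProduct, Complex.conj_mul']

/-- Since `ϑ ≤ π/2`, the sector lies in the half-plane `Re z ≥ a`; this is all that is used of it.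
-/
theorem le_re_of_numericalRange_subset {B : Matrix m m ℝ} {ϑ a : ℝ} (hϑ : ϑ ≤ Real.pi / 2)
    (hB : numericalRange B ⊆ sector ϑ a) (x : m → ℂ) :
    a * ∑ i, ‖x i‖ ^ 2 ≤ (star x ⬝ᵥ (B.map (fun r : ℝ => (r : ℂ)) *ᵥ x)).re := by
  by_cases hx : x = 0
  · simp [hx]
  have hpos : 0 < ∑ i, ‖x i‖ ^ 2 := by
    obtain ⟨i, hi⟩ := Function.ne_iff.1 hx
    exact Finset.sum_pos' (fun _ _ => by positivity) ⟨i, Finset.mem_univ i, by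
      have := norm_pos_iff.2 hi; positivity⟩
  have h := hB ⟨x, hx, rfl⟩
  have h2 := Complex.abs_arg_le_pi_div_two_iff.1 (le_trans h hϑ)
  rw [star_dotProduct_self_eq, Complex.sub_re, Complex.ofReal_re, Complex.div_ofReal_re,
    sub_nonneg, le_div_iff₀ hpos] at h2
  exact h2

theorem dotProduct_mulVec_nonneg {B : Matrix m m ℝ} {ϑ a : ℝ} (hϑ : ϑ ≤ Real.pi / 2)
    (ha : 0 ≤ a) (hB : numericalRange B ⊆ sector ϑ a) (x : m → ℝ) : 0 ≤ x ⬝ᵥ (B *ᵥ x) := by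
  have h := le_re_of_numericalRange_subset hϑ hB (fun i => (x i : ℂ))
  have e : (star (fun i => (x i : ℂ)) ⬝ᵥ
      (B.map (fun r : ℝ => (r : ℂ)) *ᵥ fun i => (x i : ℂ))) = ((x ⬝ᵥ (B *ᵥ x) : ℝ) : ℂ) := by
    simp [dotProduct, Matrix.mulVec]
  rw [e, Complex.ofReal_re] at h
  exact le_trans (by positivity) h

variable [DecidableEq m]

/-- Pair the equation with `x`, bound the quadratic form from below by the numerical range, and
apply Cauchy–Schwarz. No sign of `z.re + a` is assumed, so the case `f = 0` also locates
eigenvalues. -/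
theorem mul_norm_le_of_resolvent {B : Matrix m m ℝ} {ϑ a : ℝ} (hϑ : ϑ ≤ Real.pi / 2)
    (hB : numericalRange B ⊆ sector ϑ a) (z : ℂ) (x f : m → ℂ)
    (h : (z • (1 : Matrix m m ℂ) + B.map (fun r : ℝ => (r : ℂ))) *ᵥ x = f) :
    (z.re + a) * ‖WithLp.toLp 2 x‖ ≤ ‖WithLp.toLp 2 f‖ := by
  have h1 := le_re_of_numericalRange_subset hϑ hB x
  have hn : ∑ i, ‖x i‖ ^ 2 = ‖WithLp.toLp 2 x‖ ^ 2 := by rw [EuclideanSpace.norm_sq_eq]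
  have h2 : (z.re + a) * ‖WithLp.toLp 2 x‖ ^ 2 ≤ (star x ⬝ᵥ f).re := by
    rw [← h, Matrix.add_mulVec, Matrix.smul_mulVec, Matrix.one_mulVec, dotProduct_add,
      dotProduct_smul, star_dotProduct_self_eq, Complex.add_re, smul_eq_mul, Complex.re_mul_ofReal,
      ← hn, add_mul]
    linarith
  have h3 : (star x ⬝ᵥ f).re ≤ ‖WithLp.toLp 2 x‖ * ‖WithLp.toLp 2 f‖ := by
    have := norm_inner_le_norm (𝕜 := ℂ) (WithLp.toLp 2 x) (WithLp.toLp 2 f)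
    rw [EuclideanSpace.inner_toLp_toLp, dotProduct_comm] at this
    exact (Complex.re_le_norm _).trans this
  by_cases h0 : ‖WithLp.toLp 2 x‖ = 0
  · rw [h0, mul_zero]; positivity
  · have hp : 0 < ‖WithLp.toLp 2 x‖ := lt_of_le_of_ne (norm_nonneg _) (Ne.symm h0)
    refine le_of_mul_le_mul_left ?_ hp
    nlinarith

end NumericalRange

section Eigenvalues

variable {k : ℕ} {T : Matrix (Fin k) (Fin k) ℝ} {μ : Fin k → ℂ}

theorem det_add_eq_prod
    (hμ : (T.map (fun r : ℝ => (r : ℂ))).charpoly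
      = ∏ j : Fin k, (Polynomial.X - Polynomial.C (μ j))) (z : ℂ) :
    (z • (1 : Matrix (Fin k) (Fin k) ℂ) + T.map (fun r : ℝ => (r : ℂ))).det =
      ∏ j, (z + μ j) := by
  have h := congrArg (Polynomial.eval (-z)) hμ
  rw [Matrix.eval_charpoly, Polynomial.eval_prod] at h
  simp only [Polynomial.eval_sub, Polynomial.eval_X, Polynomial.eval_C] at h
  have e1 : Matrix.scalar (Fin k) (-z) - T.map (fun r : ℝ => (r : ℂ)) =
      -(z • (1 : Matrix (Fin k) (Fin k) ℂ) + T.map (fun r : ℝ => (r : ℂ))) := by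
    rw [Matrix.scalar_apply, ← Matrix.smul_one_eq_diagonal]
    module
  have e2 : ∏ j, (-z - μ j) = (-1) ^ k * ∏ j, (z + μ j) := by
    have : ∀ j, -z - μ j = -1 * (z + μ j) := fun j => by ring
    simp only [this, Finset.prod_mul_distrib]
    simp
  rw [e1, Matrix.det_neg, e2, Fintype.card_fin] at h
  exact mul_left_cancel₀ (pow_ne_zero _ (by norm_num)) h

/-- Both products are moduli of characteristic determinants, and a real matrix satisfies `det(conj z
+ T) = conj (det(z + T))`. No explicit pairing of conjugate eigenvalues is needed. -/
theorem prod_norm_add_conj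
    (hμ : (T.map (fun r : ℝ => (r : ℂ))).charpoly
      = ∏ j : Fin k, (Polynomial.X - Polynomial.C (μ j))) (z : ℂ) :
    ∏ j, ‖z + (starRingEnd ℂ) (μ j)‖ = ∏ j, ‖z + μ j‖ := by
  have h1 := det_add_eq_prod hμ z
  have h2 := congrArg (starRingEnd ℂ) (det_add_eq_prod hμ ((starRingEnd ℂ) z))
  rw [RingHom.map_det, map_prod] at h2
  have e : (starRingEnd ℂ).mapMatrix ((starRingEnd ℂ) z • (1 : Matrix (Fin k) (Fin k) ℂ) +
      T.map (fun r : ℝ => (r : ℂ))) = z • (1 : Matrix (Fin k) (Fin k) ℂ) +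
      T.map (fun r : ℝ => (r : ℂ)) := by
    ext i j
    by_cases hij : i = j <;> simp [hij]
  rw [e, h1] at h2
  rw [← norm_prod, ← norm_prod, h2]
  simp

theorem le_re_eigenvalue {ϑ a : ℝ} (hϑ : ϑ ≤ Real.pi / 2) (hT : numericalRange T ⊆ sector ϑ a)
    (hμ : (T.map (fun r : ℝ => (r : ℂ))).charpoly
      = ∏ j : Fin k, (Polynomial.X - Polynomial.C (μ j))) (j : Fin k) : a ≤ (μ j).re := by
  have hdet : ((-μ j) • (1 : Matrix (Fin k) (Fin k) ℂ) + T.map (fun r : ℝ => (r : ℂ))).det = 0 := by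
    rw [det_add_eq_prod hμ]
    exact Finset.prod_eq_zero (Finset.mem_univ j) (by ring)
  obtain ⟨x, hx0, hx⟩ := Matrix.exists_mulVec_eq_zero_iff.2 hdet
  have h := mul_norm_le_of_resolvent hϑ hT _ x 0 hx
  have hp : 0 < ‖WithLp.toLp 2 x‖ := norm_pos_iff.2 fun h => hx0 (by simpa using h)
  rw [WithLp.toLp_zero, norm_zero] at h
  have := nonpos_of_mul_nonpos_left h hp
  simp only [Complex.neg_re] at this
  linarith

end Eigenvalues

/-- The corner entry of the adjugate of an upper Hessenberg matrix. -/
theorem adjugate_last_zero_of_hessenberg {R : Type*} [CommRing R] {K : ℕ}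
    (Z : Matrix (Fin (K + 1)) (Fin (K + 1)) R)
    (hZ : ∀ i j : Fin (K + 1), (j : ℕ) + 1 < i → Z i j = 0) :
    Z.adjugate (Fin.last K) 0 = (-1) ^ K * ∏ i : Fin K, Z i.succ i.castSucc := by
  -- The minor omits the first row and the last column. It is upper triangular, with the subdiagonal
  -- of `Z` as its diagonal.
  rw [Matrix.adjugate_fin_succ_eq_det_submatrix, Matrix.det_of_isUpperTriangular]
  · simp
  · intro i j hij
    simp only [id] at hij
    simpa using hZ i.succ j.castSucc (by simpa using hij)

/-! ### The Arnoldi relation, the harmonic matrix and the error equation. -/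

section Arnoldi

variable {n : ℕ} (A : Matrix (Fin n) (Fin n) ℝ) (v : EuclideanSpace ℝ (Fin n))

theorem arnoldiCoeff_nonneg_sub (j : ℕ) : 0 ≤ arnoldiCoeff A v (j + 1) j := by
  simp [arnoldiCoeff]

/-- This also holds at a breakdown, where both sides are zero; hence `h_{k+1,k} = 0` needs no
separate treatment. -/
theorem arnoldiCoeff_smul_succ (j : ℕ) :
    arnoldiCoeff A v (j + 1) j • arnoldiVec A v (j + 1) = arnoldiResidue A v j := by
  have h : arnoldiVec A v (j + 1) = ‖arnoldiResidue A v j‖⁻¹ • arnoldiResidue A v j := by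
    rw [arnoldiVec]; rfl
  rw [h]
  simp only [arnoldiCoeff, Nat.succ_le_iff, lt_irrefl, if_false, if_true]
  by_cases h0 : arnoldiResidue A v j = 0
  · simp [h0]
  · rw [smul_smul, mul_inv_cancel₀ (norm_ne_zero_iff.2 h0), one_smul]

theorem toEuclideanLin_arnoldiVec (j : ℕ) :
    A.toEuclideanLin (arnoldiVec A v j) =
      ∑ i ∈ Finset.range (j + 2), arnoldiCoeff A v i j • arnoldiVec A v i := by
  rw [Finset.sum_range_succ, arnoldiCoeff_smul_succ, arnoldiResidue, Finset.sum_range]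
  have : ∀ i : Fin (j + 1), arnoldiCoeff A v i j =
      inner ℝ (arnoldiVec A v i) (A.toEuclideanLin (arnoldiVec A v j)) := fun i => by
    simp [arnoldiCoeff, Nat.le_of_lt_succ i.2]
  simp only [this]
  abel

theorem toEuclideanLin_arnoldiVec_fin {k : ℕ} (j : Fin k) :
    A.toEuclideanLin (arnoldiVec A v j) =
      ∑ i : Fin k, hessenberg A v k i j • arnoldiVec A v i +
        eLast k j • arnoldiCoeff A v k (k - 1) • arnoldiVec A v k := by
  have h1 : A.toEuclideanLin (arnoldiVec A v j) =
      ∑ i ∈ Finset.range (k + 1), arnoldiCoeff A v i j • arnoldiVec A v i := by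
    rw [toEuclideanLin_arnoldiVec]
    refine Finset.sum_subset ?_ fun i _ hi => ?_
    · intro i hi
      simp only [Finset.mem_range] at hi ⊢
      omega
    · simp only [Finset.mem_range] at hi
      have h2 : ¬ i ≤ (j : ℕ) := by omega
      have h3 : ¬ i = (j : ℕ) + 1 := by omega
      simp [arnoldiCoeff, h2, h3]
  rw [h1, Finset.sum_range_succ, Finset.sum_range]
  congr 1
  by_cases hj : (j : ℕ) + 1 = k
  · have : k - 1 = j := by omega
    simp [eLast, hj, this]
  · have h2 : ¬ k ≤ (j : ℕ) := by omega
    have h3 : ¬ k = (j : ℕ) + 1 := by omega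
    simp [eLast, hj, arnoldiCoeff, h2, h3]

/-- The matrix `V_k`. -/
def basisMatrix (k : ℕ) : Matrix (Fin n) (Fin k) ℝ := Matrix.of fun i j => arnoldiVec A v j i

theorem basisApply_eq (k : ℕ) (u : Fin k → ℝ) :
    basisApply A v k u = WithLp.toLp 2 (basisMatrix A v k *ᵥ u) := by
  ext i
  simp [basisApply, basisMatrix, Matrix.mulVec, dotProduct, mul_comm]

theorem basisMatrix_mulVec_first {k : ℕ} (hk : 0 < k) (hv : v ≠ 0) :
    basisMatrix A v k *ᵥ (‖v‖ • eFirst k) = v.ofLp := by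
  have h0 : eFirst k = Pi.single ⟨0, hk⟩ 1 := by
    ext i
    simp [eFirst, Pi.single_apply, Fin.ext_iff]
  ext i
  rw [h0, Matrix.mulVec_smul, Matrix.mulVec_single_one]
  have h1 : arnoldiVec A v 0 = ‖v‖⁻¹ • v := by rw [arnoldiVec]
  have h2 : ‖v‖ ≠ 0 := norm_ne_zero_iff.2 hv
  simp [basisMatrix, h1, h2]

/-- The quadratic form of `M_k` is `‖(I + γH_k)x‖²` plus a nonnegative term, so the kernel of `M_k`
lies in that of `I + γH_k`. -/
theorem isUnit_det_harmonicM (k : ℕ) (γ : ℝ) (hH : IsUnit (1 + γ • hessenberg A v k).det) :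
    IsUnit (harmonicM A v k γ).det := by
  rw [isUnit_iff_ne_zero]
  intro h0
  obtain ⟨x, hx0, hx⟩ := Matrix.exists_mulVec_eq_zero_iff.2 h0
  set K := 1 + γ • hessenberg A v k with hK
  have h1 : x ⬝ᵥ (harmonicM A v k γ *ᵥ x) = (K *ᵥ x) ⬝ᵥ (K *ᵥ x) +
      (γ ^ 2 * arnoldiCoeff A v k (k - 1) ^ 2) * (eLast k ⬝ᵥ x) ^ 2 := by
    rw [harmonicM, Matrix.add_mulVec, dotProduct_add, ← Matrix.mulVec_mulVec,
      Matrix.dotProduct_mulVec, Matrix.vecMul_transpose, Matrix.smul_mulVec,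
      Matrix.vecMulVec_mulVec, dotProduct_smul]
    congr 1
    simp only [op_smul_eq_smul, dotProduct_smul, smul_eq_mul]
    rw [dotProduct_comm x]
    ring
  rw [hx, dotProduct_zero] at h1
  have h2 : 0 ≤ (K *ᵥ x) ⬝ᵥ (K *ᵥ x) := Finset.sum_nonneg fun i _ => mul_self_nonneg _
  have h3 : (K *ᵥ x) ⬝ᵥ (K *ᵥ x) = 0 := by
    have : 0 ≤ (γ ^ 2 * arnoldiCoeff A v k (k - 1) ^ 2) * (eLast k ⬝ᵥ x) ^ 2 := by positivity
    linarith
  have h4 : K *ᵥ x = 0 := dotProduct_self_eq_zero.1 h3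
  exact hH.ne_zero (Matrix.exists_mulVec_eq_zero_iff.1 ⟨x, hx0, h4⟩)

/-- With `K = I + γH_k`, `Q_k⁻¹ = K⁻ᵀ M_k = K + γ²h² K⁻ᵀ e_k e_kᵀ`. The change is confined to the
last column, so the subdiagonal entries and the Hessenberg shape of `H_k` persist. -/
theorem exists_harmonicT_eq (k : ℕ) (γ : ℝ) (hγ : γ ≠ 0)
    (hH : IsUnit (1 + γ • hessenberg A v k).det) :
    ∃ w : Fin k → ℝ, harmonicT A v k γ = hessenberg A v k + Matrix.vecMulVec w (eLast k) := by
  have hM := isUnit_det_harmonicM A v k γ hH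
  set K := 1 + γ • hessenberg A v k with hK
  have hKT : IsUnit (Kᵀ).det := by rwa [Matrix.det_transpose]
  have hQ : (harmonicQ A v k γ)⁻¹ = (Kᵀ)⁻¹ * harmonicM A v k γ := by
    rw [harmonicQ, Matrix.mul_inv_rev, Matrix.nonsing_inv_nonsing_inv _ hM]
  refine ⟨(γ * arnoldiCoeff A v k (k - 1) ^ 2) • ((Kᵀ)⁻¹ *ᵥ eLast k), ?_⟩
  rw [harmonicT, hQ, harmonicM, ← hK, Matrix.mul_add, ← Matrix.mul_assoc,
    Matrix.nonsing_inv_mul _ hKT, Matrix.one_mul, Matrix.mul_smul, Matrix.mul_vecMulVec,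
    Matrix.smul_vecMulVec]
  generalize Matrix.vecMulVec ((Kᵀ)⁻¹ *ᵥ eLast k) (eLast k) = W
  have h1 : K + (γ ^ 2 * arnoldiCoeff A v k (k - 1) ^ 2) • W - 1 =
      γ • (hessenberg A v k + (γ * arnoldiCoeff A v k (k - 1) ^ 2) • W) := by
    rw [hK]; module
  rw [h1, inv_smul_smul₀ hγ]

theorem exists_mul_basisMatrix_eq (k : ℕ) (γ : ℝ) (hγ : γ ≠ 0)
    (hH : IsUnit (1 + γ • hessenberg A v k).det) :
    ∃ g : Fin n → ℝ, A * basisMatrix A v k =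
      basisMatrix A v k * harmonicT A v k γ + Matrix.vecMulVec g (eLast k) := by
  obtain ⟨w, hw⟩ := exists_harmonicT_eq A v k γ hγ hH
  -- The Arnoldi remainder `h_{k+1,k} v_{k+1}`, corrected by the part `V_k w` that has moved into
  -- `V_k T_k`.
  refine ⟨(arnoldiCoeff A v k (k - 1) • arnoldiVec A v k).ofLp - basisMatrix A v k *ᵥ w, ?_⟩
  have h1 : A * basisMatrix A v k = basisMatrix A v k * hessenberg A v k +
      Matrix.vecMulVec (arnoldiCoeff A v k (k - 1) • arnoldiVec A v k).ofLp (eLast k) := by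
    ext i j
    have h := congrArg (fun x : EuclideanSpace ℝ (Fin n) => x i)
      (toEuclideanLin_arnoldiVec_fin A v j)
    have h2 : (A * basisMatrix A v k) i j = (A.toEuclideanLin (arnoldiVec A v j)) i := by
      simp [Matrix.mul_apply, basisMatrix, Matrix.toLpLin_apply, Matrix.mulVec, dotProduct]
    rw [h2]
    simp only at h
    rw [h]
    simp only [PiLp.add_apply, WithLp.ofLp_sum, Finset.sum_apply, PiLp.smul_apply, smul_eq_mul,
      Matrix.add_apply, Matrix.mul_apply, basisMatrix, Matrix.of_apply, Matrix.vecMulVec_apply]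
    congr 1
    · exact Finset.sum_congr rfl fun _ _ => mul_comm _ _
    · ring
  rw [h1, hw, Matrix.mul_add, Matrix.mul_vecMulVec, Matrix.sub_vecMulVec]
  abel

theorem harmonicT_entry {K : ℕ} (γ : ℝ) (hγ : γ ≠ 0)
    (hH : IsUnit (1 + γ • hessenberg A v (K + 1)).det) (i : Fin (K + 1)) (j : Fin K) :
    harmonicT A v (K + 1) γ i j.castSucc = arnoldiCoeff A v i j := by
  obtain ⟨w, hw⟩ := exists_harmonicT_eq A v (K + 1) γ hγ hH
  have : (j : ℕ) ≠ K := j.2.ne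
  simp [hw, hessenberg, Matrix.vecMulVec_apply, eLast, this]

theorem harmonicApprox_eq {k : ℕ} (γ : ℝ) (l : ℕ) {s : ℝ} (hs : s ≠ 0) :
    harmonicApprox A v k γ l s = (s ^ l)⁻¹ • WithLp.toLp 2 (basisMatrix A v k *ᵥ
      phiFlow (harmonicT A v k γ) (‖v‖ • eFirst k) l s) := by
  rw [harmonicApprox, basisApply_eq, phiFlow]
  generalize phi l (-(s • harmonicT A v k γ)) *ᵥ (‖v‖ • eFirst k) = y
  rw [Matrix.mulVec_smul, WithLp.toLp_smul, inv_smul_smul₀ (pow_ne_zero _ hs)]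

theorem exactSol_eq (l : ℕ) {s : ℝ} (hs : s ≠ 0) :
    exactSol A v l s = (s ^ l)⁻¹ • WithLp.toLp 2 (phiFlow A v.ofLp l s) := by
  rw [phiFlow, WithLp.toLp_smul, inv_smul_smul₀ (pow_ne_zero _ hs)]
  rfl

theorem hasDerivAt_harmonicApprox {k : ℕ} (γ : ℝ) (l : ℕ) {s : ℝ} (hs : s ≠ 0) :
    HasDerivAt (harmonicApprox A v k γ l)
      (WithLp.toLp 2 (basisMatrix A v k *ᵥ ((s ^ l)⁻¹ • (-(harmonicT A v k γ *ᵥ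
        phiFlow (harmonicT A v k γ) (‖v‖ • eFirst k) l s) + phiSource l s • (‖v‖ • eFirst k)))) -
      (l / s) • harmonicApprox A v k γ l s) s := by
  set T := harmonicT A v k γ
  have h1 := hasDerivAt_phiFlow T (‖v‖ • eFirst k) l s
  have h2 := (WithLp.linearEquiv 2 ℝ (Fin n → ℝ)).symm.toLinearMap.comp
    (Matrix.mulVecLin (basisMatrix A v k)) |>.toContinuousLinearMap.hasFDerivAt.comp_hasDerivAt s h1
  have h3 := ((hasDerivAt_pow l s).inv (pow_ne_zero _ hs)).smul h2
  refine (h3.congr_deriv ?_).congr_of_eventuallyEq ?_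
  · rw [harmonicApprox_eq A v γ l hs, Matrix.mulVec_smul, WithLp.toLp_smul]
    change (s ^ l)⁻¹ • WithLp.toLp 2 (basisMatrix A v k *ᵥ _) +
      (-(l * s ^ (l - 1)) / (s ^ l) ^ 2) • WithLp.toLp 2 (basisMatrix A v k *ᵥ _) = _
    -- The derivative of `s^{-l}` produces the term `-(l/s) ŷ`; for `l = 0` the truncated exponent
    -- `l - 1` is multiplied by zero.
    have hb : -(l * s ^ (l - 1)) / (s ^ l) ^ 2 = -(l / s * (s ^ l)⁻¹) := by
      cases l with
      | zero => simp
      | succ p =>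
        rw [Nat.add_sub_cancel]
        field_simp
        ring
    rw [hb]
    module
  · filter_upwards [isOpen_ne.mem_nhds hs] with r hr
    exact harmonicApprox_eq A v γ l hr

/-- The approximation solves the projected equation exactly: its derivative cancels the `l/t` term,
the source term and the part `V_k T_k` of `A V_k`. Only the rank-one remainder `g e_kᵀ` is left. -/
theorem harmonicResidual_eq {k : ℕ} (hk : 0 < k) (hv : v ≠ 0) (γ : ℝ) (l : ℕ) {t : ℝ}
    (ht : t ≠ 0) {g : Fin n → ℝ} (hg : A * basisMatrix A v k =
      basisMatrix A v k * harmonicT A v k γ + Matrix.vecMulVec g (eLast k)) :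
    harmonicResidual A v k γ l t = -(‖v‖ * cornerEntry A v k γ l t) • WithLp.toLp 2 g := by
  set T := harmonicT A v k γ with hT
  set ψ := phiFlow T (‖v‖ • eFirst k) l t with hψ
  have hA : A.toEuclideanLin (harmonicApprox A v k γ l t) =
      WithLp.toLp 2 (basisMatrix A v k *ᵥ ((t ^ l)⁻¹ • (T *ᵥ ψ))) +
        (‖v‖ * cornerEntry A v k γ l t) • WithLp.toLp 2 g := by
    rw [harmonicApprox_eq A v γ l ht, map_smul, Matrix.toLpLin_toLp, Matrix.toLin'_apply,
      Matrix.mulVec_mulVec, hg,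
      Matrix.add_mulVec, Matrix.vecMulVec_mulVec, op_smul_eq_smul, Matrix.mulVec_smul,
      Matrix.mulVec_mulVec,
      WithLp.toLp_add, smul_add, WithLp.toLp_smul]
    congr 1
    rw [smul_smul]
    congr 1
    rw [phiFlow, cornerEntry, dotProduct_smul, Matrix.mulVec_smul, dotProduct_smul,
      smul_eq_mul, smul_eq_mul, inv_mul_cancel_left₀ (pow_ne_zero _ ht)]
  have hd := (hasDerivAt_harmonicApprox A v (k := k) γ l ht).deriv
  rw [smul_add, Matrix.mulVec_add, smul_smul, Matrix.mulVec_smul _ _ (‖v‖ • eFirst k),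
    basisMatrix_mulVec_first A v hk hv, WithLp.toLp_add, smul_neg, Matrix.mulVec_neg,
    WithLp.toLp_neg, WithLp.toLp_smul] at hd
  cases l with
  | zero =>
    rw [harmonicResidual, hA, hd]
    simp [phiSource, ← hT, ← hψ]
  | succ p =>
    rw [harmonicResidual, hA, hd, ← hψ]
    have : 1 / (t * (p ! : ℝ)) = (t ^ (p + 1))⁻¹ * phiSource (p + 1) t := by
      rw [phiSource]
      field_simp
      ring
    rw [this]
    simp only [WithLp.toLp_ofLp]
    module

/-- The last component of the solution of `(z + T_k) x = c e₁`. -/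
theorem prod_mul_norm_last_eq {k : ℕ} (γ : ℝ) (hγ : γ ≠ 0)
    (hH : IsUnit (1 + γ • hessenberg A v k).det) {μ : Fin k → ℂ} (hk : 0 < k)
    (hμ : ((harmonicT A v k γ).map (fun r : ℝ => (r : ℂ))).charpoly
      = ∏ j : Fin k, (Polynomial.X - Polynomial.C (μ j))) (z c : ℂ) (x : Fin k → ℂ)
    (hx : (z • (1 : Matrix (Fin k) (Fin k) ℂ) +
      (harmonicT A v k γ).map (fun r : ℝ => (r : ℂ))) *ᵥ x = fun i => c * (eFirst k i : ℂ)) :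
    (∏ j, ‖z + μ j‖) * ‖∑ j, (eLast k j : ℂ) * x j‖ =
      ‖c‖ * ∏ j ∈ Finset.range (k - 1), arnoldiCoeff A v (j + 1) j := by
  obtain ⟨K, rfl⟩ : ∃ K, k = K + 1 := ⟨k - 1, by omega⟩
  have hdet := det_add_eq_prod hμ z
  set Z := z • (1 : Matrix (Fin (K + 1)) (Fin (K + 1)) ℂ) +
    (harmonicT A v (K + 1) γ).map (fun r : ℝ => (r : ℂ)) with hZ
  have hsub : ∀ (i : Fin (K + 1)) (j : Fin K), (j : ℕ) < i →
      Z i j.castSucc = (arnoldiCoeff A v i j : ℂ) := by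
    intro i j hij
    have : i ≠ j.castSucc := fun h => by simp [h] at hij
    simp [hZ, this, harmonicT_entry A v γ hγ hH]
  have hZ0 : ∀ i j : Fin (K + 1), (j : ℕ) + 1 < i → Z i j = 0 := by
    intro i j hij
    have hj : (j : ℕ) < K := by omega
    have h := hsub i ⟨j, hj⟩ (by simp; omega)
    have h2 : ¬ (i : ℕ) ≤ j := by omega
    have h3 : ¬ (i : ℕ) = j + 1 := by omega
    simpa [arnoldiCoeff, h2, h3] using h
  have hadj := adjugate_last_zero_of_hessenberg Z hZ0
  have hlast : ∑ j, (eLast (K + 1) j : ℂ) * x j = x (Fin.last K) := by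
    rw [Fin.sum_univ_castSucc]
    have : ∀ i : Fin K, (i : ℕ) ≠ K := fun i => i.2.ne
    simp [eLast, this]
  -- Cramer's rule: after multiplication by the adjugate, the right-hand side `c e₁` selects the
  -- single corner entry.
  have h1 : Z.det * x (Fin.last K) = Z.adjugate (Fin.last K) 0 * c := by
    have h := congrFun (congrArg (fun y => Z.adjugate *ᵥ y) hx) (Fin.last K)
    simp only [Matrix.mulVec_mulVec, Matrix.adjugate_mul, Matrix.smul_mulVec, Matrix.one_mulVec,
      Pi.smul_apply, smul_eq_mul] at h
    rw [h, Matrix.mulVec, dotProduct, Fin.sum_univ_succ]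
    simp [eFirst]
  rw [hlast, ← norm_prod, ← hdet, ← norm_mul, h1, hadj, norm_mul, norm_mul, norm_pow, norm_neg,
    norm_one, one_pow, one_mul, mul_comm, norm_prod, Nat.add_sub_cancel, Finset.prod_range]
  congr 1
  refine Finset.prod_congr rfl fun i _ => ?_
  rw [hsub i.succ i (by simp), Complex.norm_real, Fin.val_succ,
    Real.norm_of_nonneg (arnoldiCoeff_nonneg_sub A v i)]

theorem norm_resolvent_error_le {k : ℕ} (γ : ℝ) (hγ : γ ≠ 0)
    (hH : IsUnit (1 + γ • hessenberg A v k).det) {μ : Fin k → ℂ} (hk : 0 < k) (hv : v ≠ 0)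
    (hμ : ((harmonicT A v k γ).map (fun r : ℝ => (r : ℂ))).charpoly
      = ∏ j : Fin k, (Polynomial.X - Polynomial.C (μ j)))
    {ϑ a : ℝ} (hϑ : ϑ ≤ Real.pi / 2) (hWA : numericalRange A ⊆ sector ϑ a)
    {g : Fin n → ℝ} (hg : A * basisMatrix A v k =
      basisMatrix A v k * harmonicT A v k γ + Matrix.vecMulVec g (eLast k))
    (z c : ℂ) (x : Fin n → ℂ) (y : Fin k → ℂ)
    (hx : (z • (1 : Matrix (Fin n) (Fin n) ℂ) + A.map (fun r : ℝ => (r : ℂ))) *ᵥ x =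
      fun i => c * (v i : ℂ))
    (hy : (z • (1 : Matrix (Fin k) (Fin k) ℂ) +
      (harmonicT A v k γ).map (fun r : ℝ => (r : ℂ))) *ᵥ y =
        fun i => c * ((‖v‖ • eFirst k) i : ℝ)) :
    (∏ j, ‖z + μ j‖) * ((z.re + a) *
      ‖WithLp.toLp 2 (x - (basisMatrix A v k).map (fun r : ℝ => (r : ℂ)) *ᵥ y)‖) ≤
      ‖c‖ * ‖v‖ * (∏ j ∈ Finset.range (k - 1), arnoldiCoeff A v (j + 1) j) *
        ‖WithLp.toLp 2 g‖ := by
  set V := (basisMatrix A v k).map (fun r : ℝ => (r : ℂ)) with hV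
  set T := (harmonicT A v k γ).map (fun r : ℝ => (r : ℂ)) with hT
  set Ac := A.map (fun r : ℝ => (r : ℂ)) with hAc
  have hcast : Ac * V = V * T + Matrix.vecMulVec (fun i => (g i : ℂ)) (fun j => (eLast k j : ℂ)) := by
    have h := congrArg (fun M : Matrix (Fin n) (Fin k) ℝ => M.map Complex.ofRealHom) hg
    simp only [Matrix.map_mul, Matrix.map_add _ (map_add Complex.ofRealHom)] at h
    refine h.trans ?_
    congr 1
    ext i j
    simp [Matrix.vecMulVec_apply]
  have hVe : V *ᵥ (fun i => c * ((‖v‖ • eFirst k) i : ℝ)) = fun i => c * (v i : ℂ) := by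
    ext i
    have h := congrFun (basisMatrix_mulVec_first A v hk hv) i
    rw [← h]
    simp only [Matrix.mulVec, dotProduct, hV, Matrix.map_apply, Complex.ofReal_sum,
      Complex.ofReal_mul, Finset.mul_sum]
    exact Finset.sum_congr rfl fun j _ => by ring
  set σ := ∑ j, (eLast k j : ℂ) * y j with hσ
  -- `(z + A)V_k = V_k(z + T_k) + g e_kᵀ`, and `V_k` maps the projected right-hand side to the full
  -- one, so these cancel.
  have hres : (z • (1 : Matrix (Fin n) (Fin n) ℂ) + Ac) *ᵥ (x - V *ᵥ y) =
      (-σ) • fun i => (g i : ℂ) := by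
    rw [Matrix.mulVec_sub, hx, ← hVe, ← hy, Matrix.mulVec_mulVec, Matrix.mulVec_mulVec,
      Matrix.add_mul, Matrix.mul_add, hcast, Matrix.smul_mul, Matrix.mul_smul, Matrix.one_mul,
      Matrix.mul_one, ← add_assoc, Matrix.add_mulVec _ (Matrix.vecMulVec _ _),
      Matrix.vecMulVec_mulVec, sub_add_cancel_left, op_smul_eq_smul, neg_smul]
    rfl
  have h1 := mul_norm_le_of_resolvent hϑ hWA z _ _ hres
  have hgn : ‖WithLp.toLp 2 fun i => (g i : ℂ)‖ = ‖WithLp.toLp 2 g‖ := by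
    rw [EuclideanSpace.norm_eq, EuclideanSpace.norm_eq]
    simp
  rw [WithLp.toLp_smul, norm_smul, norm_neg, hgn] at h1
  have h2 := prod_mul_norm_last_eq A v γ hγ hH hk hμ z (c * ‖v‖) y (by
    rw [hy]; ext i; simp [mul_assoc])
  rw [norm_mul, Complex.norm_real, norm_norm, ← hσ] at h2
  rw [← h2, mul_assoc]
  exact mul_le_mul_of_nonneg_left h1 (Finset.prod_nonneg fun _ _ => norm_nonneg _)

end Arnoldi

end HarmonicArnoldi
end

/-! ### Scalar estimates on the line `Re z = ε`. -/

noncomputable section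

namespace HarmonicArnoldi

open MeasureTheory Set

section Scalar

variable {k : ℕ} {ε : ℝ} {μ : Fin k → ℂ}

theorem rad_sq (j : Fin k) : rad ε μ j ^ 2 = (ε + (μ j).re) ^ 2 + (μ j).im ^ 2 :=
  Real.sq_sqrt (by positivity)

theorem le_rad (hε : 0 < ε) (hμ : ∀ j, 0 ≤ (μ j).re) (j : Fin k) : ε ≤ rad ε μ j :=
  Real.le_sqrt_of_sq_le (by nlinarith [hμ j, sq_nonneg (μ j).im])

theorem rad_le_radMax (j : Fin k) : rad ε μ j ≤ radMax ε μ :=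
  le_ciSup (Set.finite_range _).bddAbove j

/-- With `b = Im w`, the squared product on the right is `(r² + y²)² - 4y²b²`, and `(ε + Re w)² = r²
- b²`. After squaring and multiplying by `r²`, the two sides differ by `b²(r² - y²)² ≥ 0`. -/
theorem norm_mul_norm_conj_ge (w : ℂ) (y : ℝ) {r : ℝ} (hr : 0 < r)
    (hrw : r ^ 2 = (ε + w.re) ^ 2 + w.im ^ 2) :
    (r ^ 2 + y ^ 2) * (ε + w.re) / r ≤
      ‖(ε + y * Complex.I : ℂ) + w‖ * ‖(ε + y * Complex.I : ℂ) + (starRingEnd ℂ) w‖ := by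
  refine le_of_abs_le (abs_le_of_sq_le_sq ?_ (by positivity))
  rw [mul_pow, ← Complex.normSq_eq_norm_sq, ← Complex.normSq_eq_norm_sq, Complex.normSq_apply,
    Complex.normSq_apply, div_pow, div_le_iff₀ (by positivity)]
  simp only [Complex.add_re, Complex.add_im, Complex.ofReal_re, Complex.ofReal_im, Complex.mul_re,
    Complex.mul_im, Complex.I_re, Complex.I_im, Complex.conj_re, Complex.conj_im]
  generalize hc : ε + w.re = c at *
  have e1 : (ε + (y * 0 - 0 * 1) + w.re) = c := by rw [← hc]; ring
  rw [e1]
  generalize w.im = b at *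
  have hc2 : c ^ 2 = r ^ 2 - b ^ 2 := by linarith
  have h1 : (c * c + (0 + (y * 1 + 0 * 0) + b) * (0 + (y * 1 + 0 * 0) + b)) *
      (c * c + (0 + (y * 1 + 0 * 0) + -b) * (0 + (y * 1 + 0 * 0) + -b)) =
      (r ^ 2 + y ^ 2) ^ 2 - 4 * y ^ 2 * b ^ 2 := by
    have : c * c = r ^ 2 - b ^ 2 := by rw [← hc2]; ring
    rw [this]; ring
  rw [h1, mul_pow, hc2]
  nlinarith [sq_nonneg (b * (r ^ 2 - y ^ 2))]

/-- A majorant of the modulus, on the line `Re z = ε`, of the normalized transfer function. -/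
def freqWeight (ε : ℝ) (μ : Fin k → ℂ) (l : ℕ) (y : ℝ) : ℝ :=
  √(ε ^ 2 / (ε ^ 2 + y ^ 2)) ^ l * ∏ j, √(rad ε μ j ^ 2 / (rad ε μ j ^ 2 + y ^ 2))

theorem freqWeight_nonneg (l : ℕ) (y : ℝ) : 0 ≤ freqWeight ε μ l y :=
  mul_nonneg (by positivity) (Finset.prod_nonneg fun _ _ => Real.sqrt_nonneg _)

theorem continuous_freqWeight (hε : 0 < ε) (hμ : ∀ j, 0 ≤ (μ j).re) (l : ℕ) :
    Continuous (freqWeight ε μ l) := by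
  unfold freqWeight
  have h : ∀ r : ℝ, 0 < r → Continuous fun y : ℝ => √(r ^ 2 / (r ^ 2 + y ^ 2)) := fun r hr =>
    (continuous_const.div (by fun_prop) fun y => by positivity).sqrt
  exact ((h ε hε).pow l).mul
    (continuous_finsetProd _ fun j _ => h _ (hε.trans_le (le_rad hε hμ j)))

theorem omegaProd_le (hε : 0 < ε) (hμ : ∀ j, 0 ≤ (μ j).re) (y : ℝ)
    (hconj : ∏ j, ‖(ε + y * Complex.I : ℂ) + (starRingEnd ℂ) (μ j)‖ =
      ∏ j, ‖(ε + y * Complex.I : ℂ) + μ j‖) (l : ℕ) :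
    ε ^ l * omegaProd ε μ ≤ freqWeight ε μ l y *
      (‖(ε + y * Complex.I : ℂ)‖ ^ l * ∏ j, ‖(ε + y * Complex.I : ℂ) + μ j‖) := by
  have hr : ∀ j, 0 < rad ε μ j := fun j => hε.trans_le (le_rad hε hμ j)
  have hz : ‖(ε + y * Complex.I : ℂ)‖ = √(ε ^ 2 + y ^ 2) := by
    rw [Complex.norm_add_mul_I]
  have h1 : √(ε ^ 2 / (ε ^ 2 + y ^ 2)) ^ l * ‖(ε + y * Complex.I : ℂ)‖ ^ l = ε ^ l := by
    rw [hz, ← mul_pow, ← Real.sqrt_mul (by positivity), div_mul_cancel₀ _ (by positivity),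
      Real.sqrt_sq hε.le]
  have h2 : omegaProd ε μ ≤ (∏ j, √(rad ε μ j ^ 2 / (rad ε μ j ^ 2 + y ^ 2))) *
      ∏ j, ‖(ε + y * Complex.I : ℂ) + μ j‖ := by
    refine le_of_abs_le (abs_le_of_sq_le_sq ?_
      (mul_nonneg (Finset.prod_nonneg fun _ _ => Real.sqrt_nonneg _)
        (Finset.prod_nonneg fun _ _ => norm_nonneg _)))
    rw [mul_pow, sq (∏ j, ‖(ε + y * Complex.I : ℂ) + μ j‖)]
    -- One of the two copies in the square is replaced by the product over conjugates, so that the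
    -- factors can be compared one `j` at a time.
    nth_rewrite 2 [← hconj]
    rw [omegaProd, ← Finset.prod_pow, ← Finset.prod_pow, ← Finset.prod_mul_distrib,
      ← Finset.prod_mul_distrib]
    refine Finset.prod_le_prod (fun _ _ => by positivity) fun j _ => ?_
    have hrj := hr j
    have hc : 0 < ε + (μ j).re := by linarith [hμ j]
    rw [Real.sq_sqrt (by positivity), Real.sq_sqrt (by positivity)]
    refine le_trans (le_of_eq ?_)
      (mul_le_mul_of_nonneg_left (norm_mul_norm_conj_ge (μ j) y hrj (rad_sq j))
        (by positivity))
    field_simp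
  calc ε ^ l * omegaProd ε μ ≤ ε ^ l * _ := mul_le_mul_of_nonneg_left h2 (by positivity)
    _ = _ := by rw [← h1, freqWeight]; ring

/-- Write the fraction as `1 - y²/(r² + y²)` and use `1 - m ≤ exp(-m)`; the square root halves the
exponent. -/
theorem sqrt_div_le_exp {r y m : ℝ} (hr : 0 < r) (hm : m ≤ y ^ 2 / (r ^ 2 + y ^ 2)) :
    √(r ^ 2 / (r ^ 2 + y ^ 2)) ≤ Real.exp (-(1 / 2 * m)) := by
  rw [Real.sqrt_le_left (Real.exp_pos _).le, ← Real.exp_nat_mul]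
  have h1 : r ^ 2 / (r ^ 2 + y ^ 2) = 1 - y ^ 2 / (r ^ 2 + y ^ 2) := by
    field_simp; ring
  calc r ^ 2 / (r ^ 2 + y ^ 2) ≤ 1 - m := by rw [h1]; linarith
    _ ≤ Real.exp (-m) := Real.one_sub_le_exp_neg m
    _ = _ := by congr 1; push_cast; ring

theorem freqWeight_le_exp (hε : 0 < ε) (hμ : ∀ j, 0 ≤ (μ j).re) (l : ℕ) {y m₀ : ℝ}
    {m : Fin k → ℝ} (hm₀ : m₀ ≤ y ^ 2 / (ε ^ 2 + y ^ 2))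
    (hm : ∀ j, m j ≤ y ^ 2 / (rad ε μ j ^ 2 + y ^ 2)) :
    freqWeight ε μ l y ≤ Real.exp (-(l * (1 / 2 * m₀) + 1 / 2 * ∑ j, m j)) := by
  have h1 : √(ε ^ 2 / (ε ^ 2 + y ^ 2)) ^ l ≤ Real.exp (-(1 / 2 * m₀)) ^ l :=
    pow_le_pow_left₀ (Real.sqrt_nonneg _) (sqrt_div_le_exp hε hm₀) l
  have h2 : ∏ j, √(rad ε μ j ^ 2 / (rad ε μ j ^ 2 + y ^ 2)) ≤
      ∏ j, Real.exp (-(1 / 2 * m j)) :=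
    Finset.prod_le_prod (fun _ _ => Real.sqrt_nonneg _) fun j _ =>
      sqrt_div_le_exp (hε.trans_le (le_rad hε hμ j)) (hm j)
  refine (mul_le_mul h1 h2 (Finset.prod_nonneg fun _ _ => Real.sqrt_nonneg _)
    (by positivity)).trans (le_of_eq ?_)
  rw [← Real.exp_nat_mul, ← Real.exp_sum, ← Real.exp_add, Finset.sum_neg_distrib, Finset.mul_sum]
  congr 1
  ring

/-- `freqWeight_le_exp` yields weight `1/2` for every index; lowering some weights to `1/4` only
weakens the resulting exponential bound. -/
theorem half_add_quarter_le (k₂ : ℕ) (f : Fin k → ℝ) (hf : ∀ j, 0 ≤ f j) :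
    1 / 2 * ∑ j ∈ Finset.univ.filter (fun j : Fin k => (j : ℕ) < k₂), f j
      + 1 / 4 * ∑ j ∈ Finset.univ.filter (fun j : Fin k => k₂ ≤ (j : ℕ)), f j ≤
    1 / 2 * ∑ j, f j := by
  rw [← Finset.sum_filter_add_sum_filter_not Finset.univ (fun j : Fin k => (j : ℕ) < k₂) f]
  simp only [not_lt]
  have : 0 ≤ ∑ j ∈ Finset.univ.filter (fun j : Fin k => k₂ ≤ (j : ℕ)), f j :=
    Finset.sum_nonneg fun j _ => hf j
  linarith

theorem freqWeight_le_gaussian (hε : 0 < ε) (hμ : ∀ j, 0 ≤ (μ j).re) (k₂ l : ℕ) {y : ℝ}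
    (hy₀ : 0 ≤ y) (hy : y ≤ ε) :
    freqWeight ε μ l y ≤ Real.exp (-(sumOne ε μ k₂ l) * y ^ 2) := by
  have hy2 : y ^ 2 ≤ ε ^ 2 := pow_le_pow_left₀ hy₀ hy 2
  refine (freqWeight_le_exp hε hμ l (m₀ := y ^ 2 / (ε ^ 2 + ε ^ 2))
    (m := fun j => y ^ 2 / (rad ε μ j ^ 2 + ε ^ 2)) ?_ ?_).trans ?_
  · gcongr
  · intro j
    have := hε.trans_le (le_rad hε hμ j)
    gcongr
  · rw [Real.exp_le_exp, neg_mul, neg_le_neg_iff, sumOne]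
    have h := half_add_quarter_le k₂ (fun j => 1 / (rad ε μ j ^ 2 + ε ^ 2))
      (fun j => by positivity)
    have e1 : ∑ j, y ^ 2 / (rad ε μ j ^ 2 + ε ^ 2) =
        y ^ 2 * ∑ j, 1 / (rad ε μ j ^ 2 + ε ^ 2) := by
      rw [Finset.mul_sum]
      exact Finset.sum_congr rfl fun _ _ => by ring
    have e2 : l * (1 / 2 * (y ^ 2 / (ε ^ 2 + ε ^ 2))) = y ^ 2 * (l / (4 * ε ^ 2)) := by
      field_simp; ring
    rw [e1, e2]
    nlinarith [sq_nonneg y]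

theorem freqWeight_le_const (hε : 0 < ε) (hμ : ∀ j, 0 ≤ (μ j).re) (k₂ l : ℕ) {y : ℝ}
    (hy₀ : ε ≤ y) (hR : ε ≤ radMax ε μ) :
    freqWeight ε μ l y ≤ Real.exp (-ε ^ 2 * sumTwo ε μ k₂ l) := by
  have hy2 : ε ^ 2 ≤ y ^ 2 := pow_le_pow_left₀ hε.le hy₀ 2
  have hR0 := hε.trans_le hR
  -- The right side increases with `y`, so it is at least its value at `y = ε`; enlarging the
  -- denominator by `ε ≤ R` then gives the left side.
  have key : ∀ r : ℝ, 0 < r →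
      ε ^ 2 / (r ^ 2 + radMax ε μ ^ 2) ≤ y ^ 2 / (r ^ 2 + y ^ 2) := by
    intro r hr
    have hR2 : ε ^ 2 ≤ radMax ε μ ^ 2 := pow_le_pow_left₀ hε.le hR 2
    rw [div_le_div_iff₀ (by positivity) (by positivity)]
    nlinarith [mul_le_mul_of_nonneg_right hy2 (sq_nonneg r),
      mul_le_mul_of_nonneg_left hR2 (sq_nonneg y)]
  refine (freqWeight_le_exp hε hμ l (m₀ := ε ^ 2 / (ε ^ 2 + radMax ε μ ^ 2))
    (m := fun j => ε ^ 2 / (rad ε μ j ^ 2 + radMax ε μ ^ 2)) (key ε hε)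
    (fun j => key _ (hε.trans_le (le_rad hε hμ j)))).trans ?_
  rw [Real.exp_le_exp, neg_mul, neg_le_neg_iff, sumTwo]
  have h := half_add_quarter_le k₂ (fun j => 1 / (rad ε μ j ^ 2 + radMax ε μ ^ 2))
    (fun j => by positivity)
  have e1 : ∑ j, ε ^ 2 / (rad ε μ j ^ 2 + radMax ε μ ^ 2) =
      ε ^ 2 * ∑ j, 1 / (rad ε μ j ^ 2 + radMax ε μ ^ 2) := by
    rw [Finset.mul_sum]
    exact Finset.sum_congr rfl fun _ _ => by ring
  have e2 : l * (1 / 2 * (ε ^ 2 / (ε ^ 2 + radMax ε μ ^ 2))) =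
      ε ^ 2 * (l / (2 * (ε ^ 2 + radMax ε μ ^ 2))) := by
    field_simp
  rw [e1, e2]
  nlinarith [sq_nonneg ε]

theorem sqrt_div_mono {r R : ℝ} (hr : 0 < r) (hrR : r ≤ R) (y : ℝ) :
    √(r ^ 2 / (r ^ 2 + y ^ 2)) ≤ √(R ^ 2 / (R ^ 2 + y ^ 2)) := by
  have hR := hr.trans_le hrR
  refine Real.sqrt_le_sqrt ?_
  rw [div_le_div_iff₀ (by positivity) (by positivity)]
  nlinarith [pow_le_pow_left₀ hr.le hrR 2, sq_nonneg y,
    mul_le_mul_of_nonneg_right (pow_le_pow_left₀ hr.le hrR 2) (sq_nonneg y)]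

theorem freqWeight_le_pow (hε : 0 < ε) (hμ : ∀ j, 0 ≤ (μ j).re) (l : ℕ) (y : ℝ) :
    freqWeight ε μ l y ≤ √(ε ^ 2 / (ε ^ 2 + y ^ 2)) ^ l *
      √(radMax ε μ ^ 2 / (radMax ε μ ^ 2 + y ^ 2)) ^ k := by
  refine mul_le_mul_of_nonneg_left ?_ (by positivity)
  refine (Finset.prod_le_prod (fun _ _ => Real.sqrt_nonneg _) fun j _ =>
    sqrt_div_mono (hε.trans_le (le_rad hε hμ j)) (rad_le_radMax j) y).trans (le_of_eq ?_)
  simp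

theorem radMax_sq_div_eq {R : ℝ} (hR : 0 < R) (y : ℝ) :
    R ^ 2 / (R ^ 2 + y ^ 2) = (1 + (R⁻¹ * y) ^ 2)⁻¹ := by
  field_simp

/-- One full factor `θ` is kept to make the tail integrable; the remaining power is bounded through
`θ ≤ 1/2`. -/
theorem sqrt_pow_le_mul_rpow {θ p : ℝ} (hθ₀ : 0 < θ) (hθ : θ ≤ 1 / 2) {k : ℕ} (hp₁ : 1 ≤ p)
    (hp : p ≤ k / 2) : √θ ^ k ≤ (1 / 2) ^ (p - 1) * θ := by
  have h1 : √θ ^ k = θ ^ ((k : ℝ) / 2) := by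
    rw [Real.sqrt_eq_rpow, ← Real.rpow_natCast, ← Real.rpow_mul hθ₀.le]
    congr 1; ring
  calc √θ ^ k = θ ^ ((k : ℝ) / 2) := h1
    _ ≤ θ ^ p := Real.rpow_le_rpow_of_exponent_ge hθ₀ (by linarith) hp
    _ = θ ^ (p - 1) * θ := by
        rw [← Real.rpow_add_one hθ₀.ne']; congr 1; ring
    _ ≤ _ := mul_le_mul_of_nonneg_right
        (Real.rpow_le_rpow hθ₀.le hθ (by linarith)) hθ₀.le

theorem freqWeight_le_tail (hε : 0 < ε) (hμ : ∀ j, 0 ≤ (μ j).re) {k₂ : ℕ} (hk₂ : k₂ ≤ k)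
    (hk : 4 ≤ k + k₂) (l : ℕ) {y : ℝ} (hR : ε ≤ radMax ε μ) (hy : radMax ε μ ≤ y) :
    freqWeight ε μ l y ≤ (ε / √(ε ^ 2 + radMax ε μ ^ 2)) ^ l *
      (1 / 2 : ℝ) ^ (((k : ℝ) + (k₂ : ℝ)) / 4 - 1) * (1 + ((radMax ε μ)⁻¹ * y) ^ 2)⁻¹ := by
  have hR0 := hε.trans_le hR
  have hy2 : radMax ε μ ^ 2 ≤ y ^ 2 := pow_le_pow_left₀ hR0.le hy 2
  have hk₂' : (k₂ : ℝ) ≤ k := by exact_mod_cast hk₂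
  have hk' : (4 : ℝ) ≤ k + k₂ := by exact_mod_cast hk
  rw [← radMax_sq_div_eq hR0, mul_assoc]
  refine (freqWeight_le_pow hε hμ l y).trans ?_
  refine mul_le_mul ?_ ?_ (by positivity) (by positivity)
  · refine pow_le_pow_left₀ (Real.sqrt_nonneg _) ?_ l
    rw [Real.sqrt_div (by positivity), Real.sqrt_sq hε.le]
    gcongr
  -- Here `p = (k + k₂)/4`: `4 ≤ k + k₂` gives `1 ≤ p`, `k₂ ≤ k` gives `p ≤ k/2`, and `y ≥ R` gives
  -- `θ ≤ 1/2`.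
  · refine sqrt_pow_le_mul_rpow (by positivity) ?_ (by linarith) (by linarith)
    rw [div_le_div_iff₀ (by positivity) (by norm_num)]
    linarith

theorem integrable_inv_one_add_mul_sq {R : ℝ} (hR : 0 < R) :
    Integrable fun y : ℝ => (1 + (R⁻¹ * y) ^ 2)⁻¹ :=
  integrable_inv_one_add_sq.comp_mul_left' (inv_ne_zero hR.ne')

theorem integrable_freqWeight (hε : 0 < ε) (hμ : ∀ j, 0 ≤ (μ j).re) (hk : 2 ≤ k) (l : ℕ) :
    Integrable (freqWeight ε μ l) := by
  have hR : 0 < radMax ε μ :=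
    hε.trans_le ((le_rad hε hμ ⟨0, by omega⟩).trans (rad_le_radMax _))
  refine (integrable_inv_one_add_mul_sq hR).mono'
    (continuous_freqWeight hε hμ l).aestronglyMeasurable (Filter.Eventually.of_forall fun y => ?_)
  rw [Real.norm_of_nonneg (freqWeight_nonneg l y), ← radMax_sq_div_eq hR]
  refine (freqWeight_le_pow hε hμ l y).trans ?_
  have h1 : ∀ r : ℝ, 0 < r → √(r ^ 2 / (r ^ 2 + y ^ 2)) ≤ 1 := fun r hr =>
    Real.sqrt_le_one.2 ((div_le_one (by positivity)).2 (by nlinarith [sq_nonneg y]))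
  calc _ ≤ 1 * √(radMax ε μ ^ 2 / (radMax ε μ ^ 2 + y ^ 2)) ^ 2 := by
        refine mul_le_mul (pow_le_one₀ (Real.sqrt_nonneg _) (h1 ε hε)) ?_ (by positivity)
          zero_le_one
        exact pow_le_pow_of_le_one (Real.sqrt_nonneg _) (h1 _ hR) hk
    _ = _ := by rw [one_mul, Real.sq_sqrt (by positivity)]

theorem sumOne_pos (hε : 0 < ε) (hk : 0 < k) (k₂ l : ℕ) : 0 < sumOne ε μ k₂ l := by
  have hpos : ∀ j : Fin k, 0 < 1 / (rad ε μ j ^ 2 + ε ^ 2) := fun j => by positivity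
  rw [sumOne, add_assoc]
  refine add_pos_of_nonneg_of_pos (by positivity) ?_
  have h1 : 0 ≤ ∑ j ∈ Finset.univ.filter (fun j : Fin k => (j : ℕ) < k₂),
      1 / (rad ε μ j ^ 2 + ε ^ 2) := Finset.sum_nonneg fun j _ => (hpos j).le
  have h2 : 0 ≤ ∑ j ∈ Finset.univ.filter (fun j : Fin k => k₂ ≤ (j : ℕ)),
      1 / (rad ε μ j ^ 2 + ε ^ 2) := Finset.sum_nonneg fun j _ => (hpos j).le
  have h3 : 0 < ∑ j : Fin k, 1 / (rad ε μ j ^ 2 + ε ^ 2) :=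
    Finset.sum_pos (fun j _ => hpos j) ⟨⟨0, hk⟩, Finset.mem_univ _⟩
  rw [← Finset.sum_filter_add_sum_filter_not Finset.univ (fun j : Fin k => (j : ℕ) < k₂)] at h3
  simp only [not_lt] at h3
  linarith

theorem integral_freqWeight_le (hε : 0 < ε) (hμ : ∀ j, 0 ≤ (μ j).re) {k₂ : ℕ} (hk₂ : k₂ ≤ k)
    (hk : 4 ≤ k + k₂) (l : ℕ) : ∫ y, freqWeight ε μ l y ≤ 2 * bigC ε μ k₂ l := by
  have hk0 : 2 ≤ k := by omega
  have hR : ε ≤ radMax ε μ := (le_rad hε hμ ⟨0, by omega⟩).trans (rad_le_radMax _)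
  have hR0 := hε.trans_le hR
  have hint := integrable_freqWeight hε hμ hk0 l
  have heven : ∫ y, freqWeight ε μ l y = 2 * ∫ y in Ioi 0, freqWeight ε μ l y := by
    rw [← integral_comp_abs]
    simp [freqWeight, sq_abs]
  rw [heven]
  refine mul_le_mul_of_nonneg_left ?_ zero_le_two
  -- The half-line is cut at `ε` and at `R`, one piece for each term of `bigC`.
  rw [← Ioc_union_Ioi_eq_Ioi hε.le, setIntegral_union (Ioc_disjoint_Ioi le_rfl) measurableSet_Ioi
    hint.integrableOn hint.integrableOn, ← Ioc_union_Ioi_eq_Ioi hR,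
    setIntegral_union (Ioc_disjoint_Ioi le_rfl) measurableSet_Ioi
    hint.integrableOn hint.integrableOn, bigC, add_assoc]
  have hS := sumOne_pos (μ := μ) hε (by omega : 0 < k) k₂ l
  refine add_le_add ?_ (add_le_add ?_ ?_)
  · have hg : Integrable fun y : ℝ => Real.exp (-(sumOne ε μ k₂ l) * y ^ 2) :=
      integrable_exp_neg_mul_sq hS
    calc ∫ y in Ioc 0 ε, freqWeight ε μ l y
        ≤ ∫ y in Ioc 0 ε, Real.exp (-(sumOne ε μ k₂ l) * y ^ 2) :=
          setIntegral_mono_on hint.integrableOn hg.integrableOn measurableSet_Ioc fun y hy =>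
            freqWeight_le_gaussian hε hμ k₂ l hy.1.le hy.2
      _ ≤ ∫ y in Ioi 0, Real.exp (-(sumOne ε μ k₂ l) * y ^ 2) :=
          setIntegral_mono_set hg.integrableOn (Filter.Eventually.of_forall fun _ =>
            (Real.exp_pos _).le) (Filter.Eventually.of_forall fun _ h => h.1)
      _ = _ := by
          rw [integral_gaussian_Ioi, Real.sqrt_div Real.pi_pos.le, div_div, mul_comm 2]
  · calc ∫ y in Ioc ε (radMax ε μ), freqWeight ε μ l y
        ≤ ∫ y in Ioc ε (radMax ε μ), Real.exp (-ε ^ 2 * sumTwo ε μ k₂ l) :=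
          setIntegral_mono_on hint.integrableOn (integrableOn_const (by simp)) measurableSet_Ioc
            fun y hy => freqWeight_le_const hε hμ k₂ l hy.1.le hR
      _ = _ := by
          rw [setIntegral_const, Real.volume_real_Ioc_of_le hR, smul_eq_mul, mul_comm]
  · have hq := integrable_inv_one_add_mul_sq hR0
    calc ∫ y in Ioi (radMax ε μ), freqWeight ε μ l y
        ≤ ∫ y in Ioi (radMax ε μ), (ε / √(ε ^ 2 + radMax ε μ ^ 2)) ^ l *
          (1 / 2 : ℝ) ^ (((k : ℝ) + (k₂ : ℝ)) / 4 - 1) * (1 + ((radMax ε μ)⁻¹ * y) ^ 2)⁻¹ :=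
          setIntegral_mono_on hint.integrableOn (hq.const_mul _).integrableOn measurableSet_Ioi
            fun y hy => freqWeight_le_tail hε hμ hk₂ hk l hR (le_of_lt hy)
      _ = _ := by
          rw [integral_const_mul, integral_comp_mul_left_Ioi (fun y => (1 + y ^ 2)⁻¹) _
            (inv_pos.2 hR0), inv_mul_cancel₀ hR0.ne', integral_Ioi_inv_one_add_sq,
            Real.arctan_one, inv_inv, smul_eq_mul, mul_assoc]
          congr 1
          -- The tail integral is `R(π/2 - π/4) = πR/4`; its factor `4` raises the exponent of `2`
          -- from `(k + k₂)/4 - 1` to `(k + k₂)/4 + 1`.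
          rw [one_div, Real.inv_rpow zero_le_two, Real.rpow_sub_one two_ne_zero,
            Real.rpow_add_one two_ne_zero]
          field_simp
          ring

end Scalar

end HarmonicArnoldi
end

/-! ### Inversion of the Laplace transform on a vertical line. -/

noncomputable section

namespace HarmonicArnoldi

open MeasureTheory Set
open scoped FourierTransform

/-- A pointwise bound from a majorant of the Laplace transform on a vertical line. -/
theorem norm_le_of_norm_laplace_le {f : ℝ → ℂ} (hf : IsSubexponential f) {ε t : ℝ} (hε : 0 < ε)
    (ht : 0 < t) {G : ℝ → ℝ} (hG : Integrable G)
    (hfG : ∀ y : ℝ, ‖laplace f (ε + y * Complex.I)‖ ≤ G y) :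
    ‖f t‖ ≤ Real.exp (ε * t) / (2 * Real.pi) * ∫ y, G y := by
  -- The Fourier transform of this damped, truncated function at `ξ` is the Laplace transform of `f`
  -- at `ε + 2πiξ`.
  set F : ℝ → ℂ := (Ioi (0 : ℝ)).indicator fun s => Complex.exp (-(ε * s)) * f s with hF
  have hFint : Integrable F :=
    (integrable_indicator_iff measurableSet_Ioi).2 (hf.integrableOn (z := ε) (by simpa using hε))
  have hFour : ∀ ξ : ℝ, 𝓕 F ξ = laplace f (ε + ((2 * Real.pi * ξ : ℝ) : ℂ) * Complex.I) := by
    intro ξ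
    rw [Real.fourier_real_eq_integral_exp_smul, laplace, ← integral_indicator measurableSet_Ioi]
    refine integral_congr_ae (Filter.Eventually.of_forall fun s => ?_)
    simp only [hF, smul_eq_mul]
    by_cases hs : s ∈ Ioi (0 : ℝ)
    · rw [indicator_of_mem hs, indicator_of_mem hs, ← mul_assoc, ← Complex.exp_add]
      congr 2
      push_cast
      ring
    · rw [indicator_of_notMem hs, indicator_of_notMem hs, mul_zero]
  have h2π : (2 * Real.pi) ≠ 0 := by positivity
  have hG' : Integrable fun ξ : ℝ => G (2 * Real.pi * ξ) := hG.comp_mul_left' h2π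
  have hbound : ∀ ξ, ‖𝓕 F ξ‖ ≤ G (2 * Real.pi * ξ) := fun ξ => by
    rw [hFour]; exact hfG _
  have hcont : Continuous (𝓕 F) :=
    VectorFourier.fourierIntegral_continuous Real.continuous_fourierChar
      (by exact continuous_inner) hFint
  have hFourInt : Integrable (𝓕 F) :=
    hG'.mono' hcont.aestronglyMeasurable (Filter.Eventually.of_forall hbound)
  -- `F` may jump at `0`, so inversion is used only pointwise at `t > 0`.
  have hFt : ContinuousAt F t := by
    have hc : Continuous fun s : ℝ => Complex.exp (-(ε * s)) * f s := by
      have := hf.continuous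
      fun_prop
    refine hc.continuousAt.congr ?_
    filter_upwards [Ioi_mem_nhds ht] with s hs
    rw [hF, indicator_of_mem hs]
  have hinv := hFint.fourierInv_fourier_eq hFourInt hFt
  have h1 : ‖F t‖ ≤ ∫ ξ, G (2 * Real.pi * ξ) := by
    rw [← hinv, Real.fourierInv_eq']
    refine norm_integral_le_of_norm_le hG' (Filter.Eventually.of_forall fun ξ => ?_)
    rw [norm_smul, Complex.norm_exp_ofReal_mul_I, one_mul]
    exact hbound ξ
  rw [Measure.integral_comp_mul_left, abs_of_pos (by positivity), smul_eq_mul, hF,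
    indicator_of_mem (show t ∈ Ioi (0 : ℝ) from ht), norm_mul, Complex.norm_exp] at h1
  have h2 : (-((ε : ℂ) * t)).re = -(ε * t) := by simp
  rw [h2] at h1
  have h3 := mul_le_mul_of_nonneg_left h1 (Real.exp_pos (ε * t)).le
  rw [← mul_assoc, ← Real.exp_add, add_neg_cancel, Real.exp_zero, one_mul] at h3
  rw [div_eq_mul_inv, mul_assoc]
  exact h3

theorem norm_sum_mul_le {n : ℕ} (w : EuclideanSpace ℝ (Fin n)) (x : Fin n → ℂ) :
    ‖∑ i, (w i : ℂ) * x i‖ ≤ ‖w‖ * ‖WithLp.toLp 2 x‖ := by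
  have h := norm_inner_le_norm (𝕜 := ℂ) (WithLp.toLp 2 fun i => (w i : ℂ)) (WithLp.toLp 2 x)
  have hw : ‖WithLp.toLp 2 fun i => (w i : ℂ)‖ = ‖w‖ := by
    rw [EuclideanSpace.norm_eq, EuclideanSpace.norm_eq]
    simp
  rw [EuclideanSpace.inner_toLp_toLp, hw] at h
  refine le_trans (le_of_eq ?_) h
  simp [dotProduct, mul_comm]

theorem omegaProd_pos {k : ℕ} {ε : ℝ} {μ : Fin k → ℂ} (hε : 0 < ε) (hμ : ∀ j, 0 ≤ (μ j).re) :
    0 < omegaProd ε μ :=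
  Finset.prod_pos fun j _ => Real.sqrt_pos.2
    (mul_pos (hε.trans_le (le_rad hε hμ j)) (by linarith [hμ j]))

theorem bigC_nonneg {k : ℕ} {ε : ℝ} {μ : Fin k → ℂ} (hε : 0 < ε) (hμ : ∀ j, 0 ≤ (μ j).re)
    {k₂ : ℕ} (hk₂ : k₂ ≤ k) (hk : 4 ≤ k + k₂) (l : ℕ) : 0 ≤ bigC ε μ k₂ l := by
  have h := integral_freqWeight_le hε hμ hk₂ hk l
  have : 0 ≤ ∫ y, freqWeight ε μ l y := integral_nonneg fun y => freqWeight_nonneg l y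
  linarith

end HarmonicArnoldi
end

/-! ### The error bound. -/

open HarmonicArnoldi

theorem theorem4p6 {n : ℕ} (A : Matrix (Fin n) (Fin n) ℝ) (v : EuclideanSpace ℝ (Fin n))
    (hv : v ≠ 0)
    -- the sector that contains the numerical ranges
    (ϑ a : ℝ) (hϑ₀ : 0 ≤ ϑ) (hϑ₁ : ϑ ≤ Real.pi / 2) (ha : 0 ≤ a)
    (hWA : numericalRange A ⊆ sector ϑ a)
    -- the Arnoldi process does not break down before step `k`
    (k : ℕ) (hArnoldi : ∀ j : ℕ, j + 1 < k → arnoldiCoeff A v (j + 1) j ≠ 0)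
    -- the matrix `T_k` is defined
    (γ : ℝ) (hγ : γ ≠ 0) (hH : IsUnit (1 + γ • hessenberg A v k).det)
    (hWT : numericalRange (harmonicT A v k γ) ⊆ sector ϑ a)
    -- the eigenvalues of `T_k` with algebraic multiplicity, the `k₂` real ones first
    (μ : Fin k → ℂ)
    (hμ : ((harmonicT A v k γ).map (fun r : ℝ => (r : ℂ))).charpoly
      = ∏ j : Fin k, (Polynomial.X - Polynomial.C (μ j)))
    (k₂ : ℕ) (hk₂ : k₂ ≤ k) (hreal : ∀ j : Fin k, (j : ℕ) < k₂ ↔ (μ j).im = 0)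
    (hk : 4 ≤ k + k₂)
    (l : ℕ) (t : ℝ) (ht : 0 < t) (ε : ℝ) (hε : 0 < ε)
    -- the denominator in the constant `ĉ_{ℓ,k}` does not vanish
    (hcorner : cornerEntry A v k γ l t ≠ 0) :
    ‖harmonicError A v k γ l t‖
      ≤ smallC A v γ ε a μ l t * bigC ε μ k₂ l * ‖harmonicResidual A v k γ l t‖ := by
  have hk0 : 0 < k := by omega
  obtain ⟨g, hg⟩ := exists_mul_basisMatrix_eq A v k γ hγ hH
  have hμre : ∀ j, 0 ≤ (μ j).re := fun j => ha.trans (le_re_eigenvalue hϑ₁ hWT hμ j)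
  have hA := dotProduct_mulVec_nonneg hϑ₁ ha hWA
  have hT := dotProduct_mulVec_nonneg hϑ₁ ha hWT
  have hω := omegaProd_pos hε hμre
  have hC := bigC_nonneg hε hμre hk₂ hk l
  set T := harmonicT A v k γ with hTdef
  set w := harmonicError A v k γ l t with hw
  set c := ∏ j ∈ Finset.range (k - 1), arnoldiCoeff A v (j + 1) j with hc
  have hc0 : 0 ≤ c := Finset.prod_nonneg fun j _ => arnoldiCoeff_nonneg_sub A v j
  set V := basisMatrix A v k with hV
  set p : ℝ → Fin n → ℂ := fun s i => (phiFlow A v.ofLp l s i : ℂ) with hp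
  set q : ℝ → Fin k → ℂ := fun s j => (phiFlow T (‖v‖ • eFirst k) l s j : ℂ) with hq
  have hps := isSubexponential_phiFlow A hA v.ofLp l
  have hqs := isSubexponential_phiFlow T hT (‖v‖ • eFirst k) l
  have hVq : ∀ i, IsSubexponential fun s => ∑ j, (-(V i j) : ℂ) * q s j := fun i =>
    IsSubexponential.sum _ fun j _ => (hqs j).const_mul _
  have hEs : ∀ i, IsSubexponential fun s => p s i + ∑ j, (-(V i j) : ℂ) * q s j := fun i =>
    (hps i).add (hVq i)
  -- Pairing with the fixed vector `w`, the error at time `t`, reduces the inversion to a scalar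
  -- function. Its value at `t` is `t^l ‖w‖²`, and one factor `‖w‖` is divided out at the end.
  set f : ℝ → ℂ := fun s => ∑ i, (w i : ℂ) * (p s i + ∑ j, (-(V i j) : ℂ) * q s j) with hf
  have hfs : IsSubexponential f := IsSubexponential.sum _ fun i _ => (hEs i).const_mul _
  have hden : 0 < ε ^ l * omegaProd ε μ * (ε + a) := by positivity
  have hmajor : ∀ y : ℝ, ‖laplace f (ε + y * Complex.I)‖ ≤
      ‖w‖ * (‖v‖ * c * ‖WithLp.toLp 2 g‖) / (ε ^ l * omegaProd ε μ * (ε + a)) *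
        freqWeight ε μ l y := by
    intro y
    set z : ℂ := ε + y * Complex.I with hz
    have hzre : z.re = ε := by simp [hz]
    have hz0 : 0 < z.re := by rwa [hzre]
    have hzn : z ≠ 0 := fun h => by simp [h] at hz0
    set X : Fin n → ℂ := fun i => laplace (fun s => p s i) z with hX
    set Y : Fin k → ℂ := fun j => laplace (fun s => q s j) z with hY
    have h1 : laplace f z = ∑ i, (w i : ℂ) *
        (X - V.map (fun r : ℝ => (r : ℂ)) *ᵥ Y) i := by
      rw [hf, laplace_sum _ (fun i _ => (hEs i).const_mul _) hz0]
      refine Finset.sum_congr rfl fun i _ => ?_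
      rw [laplace_const_mul, laplace_add (hps i) (hVq i) hz0,
        laplace_sum _ (fun j _ => (hqs j).const_mul _) hz0]
      simp only [laplace_const_mul]
      simp only [Pi.sub_apply, Matrix.mulVec, dotProduct, Matrix.map_apply, neg_mul,
        Finset.sum_neg_distrib, ← sub_eq_add_neg, hX, hY, hp, hq]
    have h2 := norm_resolvent_error_le A v γ hγ hH hk0 hv hμ hϑ₁ hWA hg z ((z ^ l)⁻¹) X Y
      (laplace_phiFlow A hA v.ofLp l hz0) (laplace_phiFlow T hT _ l hz0)
    have h3 := omegaProd_le hε hμre y (prod_norm_add_conj hμ z) l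
    rw [← hz] at h3
    rw [h1]
    refine (norm_sum_mul_le w _).trans ?_
    rw [mul_div_assoc, mul_assoc]
    refine mul_le_mul_of_nonneg_left ?_ (norm_nonneg w)
    rw [div_mul_eq_mul_div, le_div_iff₀ hden]
    set d := ‖WithLp.toLp 2 (X - V.map (fun r : ℝ => (r : ℂ)) *ᵥ Y)‖ with hd
    have hd0 : 0 ≤ (ε + a) * d := mul_nonneg (by positivity) (norm_nonneg _)
    rw [hzre, norm_inv, norm_pow] at h2
    have hzl : 0 < ‖z‖ ^ l := pow_pos (norm_pos_iff.2 hzn) l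
    calc d * (ε ^ l * omegaProd ε μ * (ε + a)) = ε ^ l * omegaProd ε μ * ((ε + a) * d) := by ring
      _ ≤ freqWeight ε μ l y * (‖z‖ ^ l * ∏ j, ‖z + μ j‖) * ((ε + a) * d) :=
        mul_le_mul_of_nonneg_right h3 hd0
      _ = freqWeight ε μ l y * ‖z‖ ^ l * ((∏ j, ‖z + μ j‖) * ((ε + a) * d)) := by ring
      _ ≤ freqWeight ε μ l y * ‖z‖ ^ l * ((‖z‖ ^ l)⁻¹ * ‖v‖ * c * ‖WithLp.toLp 2 g‖) :=
        mul_le_mul_of_nonneg_left h2 (mul_nonneg (freqWeight_nonneg l y) hzl.le)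
      _ = ‖v‖ * c * ‖WithLp.toLp 2 g‖ * freqWeight ε μ l y := by
        field_simp
  have hmain := norm_le_of_norm_laplace_le hfs hε ht
    ((integrable_freqWeight hε hμre (by omega) l).const_mul _) hmajor
  have hft : ‖f t‖ = t ^ l * ‖w‖ ^ 2 := by
    have h1 : ∀ i, p t i + ∑ j, (-(V i j) : ℂ) * q t j = ((t ^ l * w i : ℝ) : ℂ) := by
      intro i
      rw [hw, harmonicError, exactSol_eq A v l ht.ne', harmonicApprox_eq A v γ l ht.ne', ← smul_sub,
        PiLp.smul_apply, smul_eq_mul, mul_inv_cancel_left₀ (pow_ne_zero _ ht.ne')]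
      simp [hp, hq, Matrix.mulVec, dotProduct, sub_eq_add_neg, hV, hTdef]
    have h2 : f t = ((t ^ l * ‖w‖ ^ 2 : ℝ) : ℂ) := by
      simp only [hf, h1]
      rw [EuclideanSpace.norm_sq_eq, Finset.mul_sum, Complex.ofReal_sum]
      refine Finset.sum_congr rfl fun i _ => ?_
      rw [← Complex.ofReal_mul, Real.norm_eq_abs, sq_abs]
      congr 1
      ring
    rw [h2, Complex.norm_real, Real.norm_of_nonneg (by positivity)]
  rw [hft, MeasureTheory.integral_const_mul] at hmain
  have hres : ‖harmonicResidual A v k γ l t‖ =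
      ‖v‖ * |cornerEntry A v k γ l t| * ‖WithLp.toLp 2 g‖ := by
    rw [harmonicResidual_eq A v hk0 hv γ l ht.ne' hg, norm_smul, norm_neg, norm_mul, norm_norm,
      Real.norm_eq_abs]
  have hcorner' : 0 < |cornerEntry A v k γ l t| := abs_pos.2 hcorner
  -- The corner entry in the residual norm cancels the one in the denominator of `smallC`, and
  -- `(tε)^l` splits off the factor `t^l` carried by `f t`.
  have htarget : smallC A v γ ε a μ l t * bigC ε μ k₂ l * ‖harmonicResidual A v k γ l t‖ =
      Real.exp (ε * t) / Real.pi * ((‖v‖ * c * ‖WithLp.toLp 2 g‖) /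
        (ε ^ l * omegaProd ε μ * (ε + a)) * bigC ε μ k₂ l) / t ^ l := by
    rw [hres, smallC, mul_pow, mul_comm t ε, ← hc]
    field_simp
  rw [htarget, le_div_iff₀ (by positivity)]
  have hbound : t ^ l * ‖w‖ ^ 2 ≤ ‖w‖ * (Real.exp (ε * t) / Real.pi *
      ((‖v‖ * c * ‖WithLp.toLp 2 g‖) / (ε ^ l * omegaProd ε μ * (ε + a)) * bigC ε μ k₂ l)) := by
    -- The factor `2` in the integral bound cancels that of `1/(2π)` in the inversion formula.
    refine hmain.trans ?_
    refine (mul_le_mul_of_nonneg_left (mul_le_mul_of_nonneg_left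
      (integral_freqWeight_le hε hμre hk₂ hk l) (by positivity)) (by positivity)).trans
      (le_of_eq ?_)
    field_simp
  by_cases h0 : ‖w‖ = 0
  · rw [h0, zero_mul]; positivity
  · have hpos : 0 < ‖w‖ := lt_of_le_of_ne (norm_nonneg _) (Ne.symm h0)
    refine le_of_mul_le_mul_left ?_ hpos
    calc ‖w‖ * (‖w‖ * t ^ l) = t ^ l * ‖w‖ ^ 2 := by ring
      _ ≤ _ := hbound
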